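/- For $n\ge 1$ and sequences $(a_j)_{j\in\mathbb Z},(b_j)_{j\in\mathbb Z}$ of complex numbers, let $T_{n,g}$ be the $n\times n$ matrix whose $(i,j)$ entry ($1\le i,j\le n$) is $a_{i-j}$ if $i+j\le n$ and $b_{i-j}$ if $i+j\ge n+1$; let $P_n$ be the backward identity permutation matrix, and let $H_n=P_nT_{n,g}$ be the asymmetric Hankel matrix with inputs $(a_j),(b_j)$. For a random $n\times n$ matrix $B$ put $\varphi_n(B)=\frac1n\mathbf E[\operatorname{Tr}B]$. Assumption. For every $n$, the pairs $(a_{j,n},b_{j,n})$, $j\in\mathbb Z$, of complex random variables $a_{j,n}=x_{j,n}+\mathrm i y_{j,n}$, $b_{j,n}=x'_{j,n}+\mathrm i y'_{j,n}$ are independent across $j$; all variables satisfy $\mathbf E a_{j,n}=\mathbf E b_{j,n}=0$, $\mathbf E|a_{j,n}|^2=\mathbf E|b_{j,n}|^2=1$, $\mathbf E x_{j,n}^2=\mathbf E y_{j,n}^2$ and $\mathbf E x_{j,n}'^2=\mathbf E y_{j,n}'^2$; for all $j,n$, $$\mathbf E[x_{j,n}y_{j,n}]=\rho_1,\quad \mathbf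 E[x_{j,n}x'_{j,n}]=\rho_2,\quad \mathbf E[x_{j,n}y'_{j,n}]=\rho_3,\quad \mathbf E[x'_{j,n}y_{j,n}]=\rho_4,\quad \mathbf E[x'_{j,n}y'_{j,n}]=\rho_5,\quad \mathbf E[y_{j,n}y'_{j,n}]=\rho_6;$$ and for every $k\ge1$ the $k$-th absolute moments of $x_{j,n},y_{j,n},x'_{j,n},y'_{j,n}$ are bounded by a constant $c_k<\infty$ that does not depend on $j,n$. Statement. Let $H_n^{(1)},\dots,H_n^{(m)}$ be independent Hankel matrices whose inputs all satisfy the Assumption with the same $\rho_1,\dots,\rho_6$. Then $n^{-1/2}H_n^{(1)},\dots,n^{-1/2}H_n^{(m)}$ converge jointly in $*$-distribution: there are a unital complex $*$-algebra $\mathcal A$, a linear functional $\varphi$ on $\mathcal A$ with $\varphi(1)=1$ and $\varphi(aa^*)\ge0$ for all $a$, and elements $h_1,\dots,h_m\in\mathcal A$ such that for all $p$, $\epsilon_1,\dots,\epsilon_p\in\{1,*\}$ and $\tau_1,\dots,\tau_p\in\{1,\dots,m\}$, $$\lim_{n\to\infty}\varphi_n\Big(\tfrac{H_n^{(\tau_1)\epsilon_1}}{n^{1/2}}\cdots\tfrac{H_n^{(\tau_p)\epsilon_p}}{n^{1/2}}\Big)=\varphi\big(h_{\tau_1}^{\epsilon_1}\cdots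 h_{\tau_p}^{\epsilon_p}\big).$$ This limit is $0$ if $p$ is odd, and if $p=2k$ it equals $$\sum_{\pi\in\mathcal P_2(2k)}\int_0^1\int_{[-1,1]^k}\prod_{(r,s)\in\pi}\delta_{\tau_r,\tau_s}\,\mathcal E^{(H)}_{r,s}(z_0,\dots,z_k)\,dz_1\cdots dz_k\,dz_0 ,$$ where $\mathcal P_2(2k)$ is the set of pair partitions $\pi=\{(r_1,s_1),\dots,(r_k,s_k)\}$ of $\{1,\dots,2k\}$ with $r_1<\dots<r_k$ and $r_t<s_t$, and $\mathcal E^{(H)}_{r,s}$ is defined as follows. Let $\pi'(r_t)=\pi'(s_t)=t$; $\epsilon'=1$ if $\epsilon=1$ and $\epsilon'=-1$ if $\epsilon=*$; $\nu_t=(-1)^t$; $0^0=1$; $$\tilde{\mathcal A}_z=[\max\{0,-z\},\tfrac12(1-z)],\qquad \tilde{\mathcal B}_z=[\tfrac12(1-z),\min\{1-z,1\}];$$ $$w_t=z_0+\sum_{\ell=t+1}^{2k}\nu_\ell z_{\pi'(\ell)},\qquad u_t=\begin{cases}w_t&\text{if }\epsilon'_t\nu_t=1,\\1-w_t&\text{if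 }\epsilon'_t\nu_t=-1,\end{cases}$$ $$\alpha_t=\mathbf 1_{\tilde{\mathcal A}_{\epsilon'_tz_{\pi'(t)}}}(u_t),\qquad \beta_t=\mathbf 1_{\tilde{\mathcal B}_{\epsilon'_tz_{\pi'(t)}}}(u_t).$$ With $d=\delta_{\epsilon_r,\epsilon_s}$ and $\kappa(e)=[\rho_2+\rho_6+e\,\mathrm i(\rho_4-\rho_3)]^{1-d}\,[\rho_2-\rho_6+e\,\mathrm i(\rho_4+\rho_3)]^{d}$, $$\mathcal E^{(H)}_{r,s}=\Big[[2\mathrm i\epsilon'_r\rho_1]^{d}\alpha_r\alpha_s+[2\mathrm i\epsilon'_r\rho_5]^{d}\beta_r\beta_s+\kappa(\epsilon'_r)\,\alpha_r\beta_s+\kappa(\epsilon'_s)\,\beta_r\alpha_s\Big](1-\delta_{\nu_r,\nu_s}).$$ -/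

import Mathlib

open MeasureTheory ProbabilityTheory Filter Topology

noncomputable section

/-- An exponent in `{1, *}`. -/
inductive StarExp
  | one
  | star
  deriving DecidableEq

/-- `x ^ ε` for `ε ∈ {1, *}`. -/
def StarExp.app {A : Type*} [Star A] (ε : StarExp) (x : A) : A :=
  match ε with
  | .one => x
  | .star => Star.star x

/-- The sign `ε'`, which is `1` for `ε = 1` and `-1` for `ε = *`. -/
def StarExp.sign (ε : StarExp) : ℤ :=
  match ε with
  | .one => 1
  | .star => -1

/-- The monomial `h_{τ₁}^{ε₁} ⋯ h_{τ_p}^{ε_p}`. -/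
def starWord {A : Type*} [Monoid A] [Star A] {m p : ℕ}
    (h : Fin m → A) (τ : Fin p → Fin m) (ε : Fin p → StarExp) : A :=
  (List.ofFn fun t => (ε t).app (h (τ t))).prod

/-- A state on a unital complex `*`-algebra: `φ(1) = 1` and `φ(a a*) ≥ 0`. A `*`-probability
space is a unital complex `*`-algebra with such a functional. -/
structure IsStarState {A : Type*} [Ring A] [StarRing A] [Algebra ℂ A]
    (φ : A →ₗ[ℂ] ℂ) : Prop where
  map_one : φ 1 = 1
  nonneg : ∀ a : A, 0 ≤ (φ (a * star a)).re ∧ (φ (a * star a)).im = 0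

/-- `φ_n(B) = n⁻¹ E[Tr B]` for a random `n × n` matrix `B`. -/
def expTrace {Ω : Type*} [MeasurableSpace Ω] (P : Measure Ω) {n : ℕ}
    (B : Ω → Matrix (Fin n) (Fin n) ℂ) : ℂ :=
  (n : ℂ)⁻¹ * ∫ ω, (B ω).trace ∂P

/-- Joint convergence in `*`-distribution of `m` sequences of random matrices to the elements
`h 0, …, h (m - 1)` of `(A, φ)`. -/
def ConvergesInStarDistribution {Ω : ℕ → Type*} [∀ n, MeasurableSpace (Ω n)]
    (P : ∀ n, Measure (Ω n)) {m : ℕ}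
    (M : ∀ n, Fin m → Ω n → Matrix (Fin n) (Fin n) ℂ)
    {A : Type*} [Ring A] [StarRing A] [Algebra ℂ A] (φ : A →ₗ[ℂ] ℂ) (h : Fin m → A) : Prop :=
  ∀ (p : ℕ) (τ : Fin p → Fin m) (ε : Fin p → StarExp),
    Tendsto (fun n => expTrace (P n) (fun ω => starWord (fun i => M n i ω) τ ε))
      atTop (𝓝 (φ (starWord h τ ε)))

/-- The backward identity permutation matrix `P_n`. -/
def backwardIdentity (n : ℕ) : Matrix (Fin n) (Fin n) ℂ :=
  Matrix.of fun i j => if j = Fin.rev i then 1 else 0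

/-- The generalized Toeplitz matrix `T_{n,g}`: with indices starting from `1`, its `(i, j)` entry
is `a_{i-j}` if `i + j ≤ n` and `b_{i-j}` if `i + j ≥ n + 1`. -/
def genToeplitz (n : ℕ) (a b : ℤ → ℂ) : Matrix (Fin n) (Fin n) ℂ :=
  Matrix.of fun i j =>
    if (i.val + 1) + (j.val + 1) ≤ n then a ((i.val : ℤ) - (j.val : ℤ))
    else b ((i.val : ℤ) - (j.val : ℤ))

/-- The asymmetric Hankel matrix `H_n = P_n T_{n,g}`. -/
def hankel (n : ℕ) (a b : ℤ → ℂ) : Matrix (Fin n) (Fin n) ℂ :=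
  backwardIdentity n * genToeplitz n a b

/-- The six correlation parameters. -/
structure Correlations where
  ρ₁ : ℝ
  ρ₂ : ℝ
  ρ₃ : ℝ
  ρ₄ : ℝ
  ρ₅ : ℝ
  ρ₆ : ℝ

/-- The complex variable with real part `x` and imaginary part `y`. -/
def toComplex {Ω : Type*} (x y : Ω → ℝ) (ω : Ω) : ℂ := (x ω : ℂ) + Complex.I * (y ω : ℂ)

/-- The assumption on the input variables `a_{j,n} = x_{j,n} + i y_{j,n}` and
`b_{j,n} = x'_{j,n} + i y'_{j,n}` (written `u` and `v` for `x'` and `y'`): the pairs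
`(a_{j,n}, b_{j,n})` are independent across `j`, all variables are centred with variance one, the
real and imaginary parts have equal second moments, the correlations inside a pair are
`ρ₁, …, ρ₆`, and all moments are bounded uniformly in `j` and `n`. -/
structure InputAssumption {Ω : ℕ → Type*} [∀ n, MeasurableSpace (Ω n)]
    (P : ∀ n, Measure (Ω n)) (ρ : Correlations) (x y u v : ∀ n, ℤ → Ω n → ℝ) : Prop where
  measurable_x : ∀ n j, Measurable (x n j)
  measurable_y : ∀ n j, Measurable (y n j)
  measurable_u : ∀ n j, Measurable (u n j)
  measurable_v : ∀ n j, Measurable (v n j)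
  indep : ∀ n, iIndepFun
    (fun (j : ℤ) (ω : Ω n) => (toComplex (x n j) (y n j) ω, toComplex (u n j) (v n j) ω)) (P n)
  mean_a : ∀ n j, ∫ ω, toComplex (x n j) (y n j) ω ∂(P n) = 0
  mean_b : ∀ n j, ∫ ω, toComplex (u n j) (v n j) ω ∂(P n) = 0
  variance_a : ∀ n j, ∫ ω, ‖toComplex (x n j) (y n j) ω‖ ^ 2 ∂(P n) = 1
  variance_b : ∀ n j, ∫ ω, ‖toComplex (u n j) (v n j) ω‖ ^ 2 ∂(P n) = 1
  balanced_a : ∀ n j, ∫ ω, x n j ω ^ 2 ∂(P n) = ∫ ω, y n j ω ^ 2 ∂(P n)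
  balanced_b : ∀ n j, ∫ ω, u n j ω ^ 2 ∂(P n) = ∫ ω, v n j ω ^ 2 ∂(P n)
  corr₁ : ∀ n j, ∫ ω, x n j ω * y n j ω ∂(P n) = ρ.ρ₁
  corr₂ : ∀ n j, ∫ ω, x n j ω * u n j ω ∂(P n) = ρ.ρ₂
  corr₃ : ∀ n j, ∫ ω, x n j ω * v n j ω ∂(P n) = ρ.ρ₃
  corr₄ : ∀ n j, ∫ ω, u n j ω * y n j ω ∂(P n) = ρ.ρ₄
  corr₅ : ∀ n j, ∫ ω, u n j ω * v n j ω ∂(P n) = ρ.ρ₅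
  corr₆ : ∀ n j, ∫ ω, y n j ω * v n j ω ∂(P n) = ρ.ρ₆
  moments : ∃ c : ℕ → ℝ, ∀ k, 1 ≤ k → ∀ n j,
    (Integrable (fun ω => |x n j ω| ^ k) (P n) ∧ ∫ ω, |x n j ω| ^ k ∂(P n) ≤ c k) ∧
    (Integrable (fun ω => |y n j ω| ^ k) (P n) ∧ ∫ ω, |y n j ω| ^ k ∂(P n) ≤ c k) ∧
    (Integrable (fun ω => |u n j ω| ^ k) (P n) ∧ ∫ ω, |u n j ω| ^ k ∂(P n) ≤ c k) ∧
    (Integrable (fun ω => |v n j ω| ^ k) (P n) ∧ ∫ ω, |v n j ω| ^ k ∂(P n) ≤ c k)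

/-- A pair partition `{(r₁,s₁), …, (r_k,s_k)}` of a set of `2k` points, written with
`r₁ < ⋯ < r_k` and `r_t < s_t`. -/
@[ext]
structure PairPartition (k : ℕ) where
  r : Fin k → Fin (2 * k)
  s : Fin k → Fin (2 * k)
  r_strictMono : StrictMono r
  r_lt_s : ∀ t, r t < s t
  cover : ∀ i, ∃! t, i = r t ∨ i = s t

instance (k : ℕ) : Fintype (PairPartition k) :=
  @Fintype.ofFinite _ (Finite.of_injective (fun π : PairPartition k => (π.r, π.s))
    (fun _ _ h => PairPartition.ext (congrArg Prod.fst h) (congrArg Prod.snd h)))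

namespace PairPartition

/-- The projection `π'`: the label of the block that contains `i`. -/
def block {k : ℕ} (π : PairPartition k) (i : Fin (2 * k)) : Fin k := (π.cover i).choose

end PairPartition

/-- `ν_t = 1` for even `t` and `-1` for odd `t`, where the positions are numbered from `1` to `2k`
(so `t : Fin (2 * k)` stands for the position `t + 1`). -/
def nu {k : ℕ} (t : Fin (2 * k)) : ℤ := if Even (t.val + 1) then 1 else -1

/-- The interval `Ã_z = [max(0,-z), (1-z)/2]`. -/
def limA (z : ℝ) : Set ℝ := Set.Icc (max 0 (-z)) ((1 - z) / 2)

/-- The interval `B̃_z = [(1-z)/2, min(1-z,1)]`. -/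
def limB (z : ℝ) : Set ℝ := Set.Icc ((1 - z) / 2) (min (1 - z) 1)

/-- `z₀ + ∑_{ℓ > t} ν_ℓ z_{π'(ℓ)}`. -/
def tailSum {k : ℕ} (π : PairPartition k) (z₀ : ℝ) (z : Fin k → ℝ) (t : Fin (2 * k)) : ℝ :=
  z₀ + ∑ ℓ ∈ Finset.Ioi t, (nu ℓ : ℝ) * z (π.block ℓ)

/-- The rescaled column of `T_{n,g}` or of `T_{n,g}^*` that the `t`-th factor of the trace uses.
The factors `P_n` in `H_n = P_n T_{n,g}` and `H_n^* = T_{n,g}^* P_n` reflect the column at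
every other step. -/
def pathPoint {k : ℕ} (π : PairPartition k) (ε : Fin (2 * k) → StarExp) (z₀ : ℝ) (z : Fin k → ℝ)
    (t : Fin (2 * k)) : ℝ :=
  if (ε t).sign * nu t = 1 then tailSum π z₀ z t else 1 - tailSum π z₀ z t

/-- The indicator that the `t`-th factor is an `a`-entry, in the limit. -/
def indA {k : ℕ} (π : PairPartition k) (ε : Fin (2 * k) → StarExp) (z₀ : ℝ) (z : Fin k → ℝ)
    (t : Fin (2 * k)) : ℂ :=
  (limA (((ε t).sign : ℝ) * z (π.block t))).indicator (fun _ => 1) (pathPoint π ε z₀ z t)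

/-- The indicator that the `t`-th factor is a `b`-entry, in the limit. -/
def indB {k : ℕ} (π : PairPartition k) (ε : Fin (2 * k) → StarExp) (z₀ : ℝ) (z : Fin k → ℝ)
    (t : Fin (2 * k)) : ℂ :=
  (limB (((ε t).sign : ℝ) * z (π.block t))).indicator (fun _ => 1) (pathPoint π ε z₀ z t)

/-- The Kronecker delta as a natural number. -/
def kron {α : Type*} [DecidableEq α] (i j : α) : ℕ := if i = j then 1 else 0

/-- The coefficient of a mixed pair, an `a`-entry with exponent of sign `e` and a `b`-entry; `d` is
`1` if the two exponents agree and `0` otherwise. -/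
def mixedCoeff (ρ : Correlations) (e : ℤ) (d : ℕ) : ℂ :=
  ((ρ.ρ₂ + ρ.ρ₆ : ℂ) + (e : ℂ) * Complex.I * (ρ.ρ₄ - ρ.ρ₃ : ℂ)) ^ (1 - d) *
    ((ρ.ρ₂ - ρ.ρ₆ : ℂ) + (e : ℂ) * Complex.I * (ρ.ρ₄ + ρ.ρ₃ : ℂ)) ^ d

/-- The function `E^{(H)}_{r,s}(z₀, z)`. -/
def hankelE {k : ℕ} (ρ : Correlations) (π : PairPartition k) (ε : Fin (2 * k) → StarExp)
    (r s : Fin (2 * k)) (z₀ : ℝ) (z : Fin k → ℝ) : ℂ :=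
  (((((ε r).sign : ℂ) * 2 * Complex.I * (ρ.ρ₁ : ℂ)) ^ kron (ε r) (ε s)) *
      (indA π ε z₀ z r * indA π ε z₀ z s) +
    ((((ε r).sign : ℂ) * 2 * Complex.I * (ρ.ρ₅ : ℂ)) ^ kron (ε r) (ε s)) *
      (indB π ε z₀ z r * indB π ε z₀ z s) +
    mixedCoeff ρ (ε r).sign (kron (ε r) (ε s)) * (indA π ε z₀ z r * indB π ε z₀ z s) +
    mixedCoeff ρ (ε s).sign (kron (ε r) (ε s)) * (indB π ε z₀ z r * indA π ε z₀ z s)) *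
  (1 - (kron (nu r) (nu s) : ℂ))

/-- The limiting even `*`-moment: the sum over pair partitions of
`∫_0^1 ∫_{[-1,1]^k} ∏_{(r,s) ∈ π} δ_{τ_r,τ_s} E^{(H)}_{r,s}`. -/
def hankelMoment {m k : ℕ} (ρ : Correlations) (τ : Fin (2 * k) → Fin m)
    (ε : Fin (2 * k) → StarExp) : ℂ :=
  ∑ π : PairPartition k,
    ∫ z₀ in Set.Icc (0 : ℝ) 1, ∫ z in Set.Icc (fun _ : Fin k => (-1 : ℝ)) (fun _ => 1),
      ∏ t : Fin k, (kron (τ (π.r t)) (τ (π.s t)) : ℂ) * hankelE ρ π ε (π.r t) (π.s t) z₀ z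

end

/-!
The expected trace of a word of length `p` expands over the closed index paths of length `p`.
The step from `i` to `j` uses the input with index `n - 1 - i - j`, so a path is determined by its
end point and the inputs it uses. A path that uses some input pair only once has mean `0`, and the
paths that use fewer than `p / 2` input pairs are too few for the normalization `n ^ (1 + p / 2)`.
In the remaining paths the inputs are paired exactly, by a pair partition `π`, and the expectation
is a product of covariances over the blocks of `π`.

Reflecting every other vertex turns the Hankel steps into translations with the signs `ν`. The paths
matched by `π` become the lattice points `(q, J) ∈ ℤ × ℤᵏ` that satisfy the closing equation
`∑ ℓ, ν_ℓ J_{π'(ℓ)} = 0` and stay in range. The closing equation is automatic if every block joins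
positions of opposite parity, and holds only on a null set in the limit otherwise; what is left is a
Riemann sum for the integral over `[0, 1] × [-1, 1]ᵏ`.

The limiting functional is defined on `*`-polynomials, where it is positive as a limit of
expected traces.
-/

open scoped Finset

namespace PairPartition

variable {k : ℕ} (π : PairPartition k)

lemma block_spec (i : Fin (2 * k)) : i = π.r (π.block i) ∨ i = π.s (π.block i) :=
  (π.cover i).choose_spec.1

lemma block_eq {i : Fin (2 * k)} {t : Fin k} (h : i = π.r t ∨ i = π.s t) : π.block i = t :=
  (π.cover i).unique (π.block_spec i) h

@[simp] lemma block_r (t : Fin k) : π.block (π.r t) = t := π.block_eq (Or.inl rfl)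

@[simp] lemma block_s (t : Fin k) : π.block (π.s t) = t := π.block_eq (Or.inr rfl)

lemma r_ne_s (t : Fin k) : π.r t ≠ π.s t := (π.r_lt_s t).ne

end PairPartition

section Fibers

/-- Every value of `K` is taken at exactly two positions. This is the pattern in which the inputs
along a closed path must repeat in order to contribute to the limit. -/
def IsTwoToOne {ι κ : Type*} (K : ι → κ) : Prop :=
  ∀ i, ∃ j, j ≠ i ∧ ∀ l, K l = K i ↔ l = i ∨ l = j

/-- The positions at which a value of `K` occurs for the first time. -/
def fiberMinima {ι κ : Type*} [Fintype ι] [LinearOrder ι] [DecidableEq κ] (K : ι → κ) : Finset ι :=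
  {i | ∀ j, K j = K i → i ≤ j}

variable {ι κ : Type*} {K : ι → κ}

lemma IsTwoToOne.eq_or_eq (h : IsTwoToOne K) {a b j : ι} (hab : a ≠ b) (hb : K b = K a)
    (hj : K j = K a) : j = a ∨ j = b := by
  obtain ⟨c, -, hc⟩ := h a
  obtain rfl : b = c := ((hc b).1 hb).resolve_left hab.symm
  exact (hc j).1 hj

section Fintype

variable [Fintype ι] [DecidableEq κ]

lemma isTwoToOne_iff_card_fiber : IsTwoToOne K ↔ ∀ i, #{j | K j = K i} = 2 := by
  classical
  refine forall_congr' fun i => ⟨fun ⟨j, hji, hj⟩ => ?_, fun h => ?_⟩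
  · refine Finset.card_eq_two.2 ⟨i, j, hji.symm, ?_⟩
    ext l
    simp [hj]
  · obtain ⟨j, hj, hji⟩ := Finset.exists_mem_ne (h ▸ one_lt_two) i
    have hpair : {i, j} = ({l | K l = K i} : Finset ι) := by
      refine Finset.eq_of_subset_of_card_le ?_ (by rw [h, Finset.card_pair hji.symm])
      simpa [Finset.insert_subset_iff] using hj
    exact ⟨j, hji, fun l => by simpa using (Finset.ext_iff.1 hpair l).symm⟩

lemma sum_card_fiber (K : ι → κ) :
    ∑ b ∈ Finset.univ.image K, #{i | K i = b} = Fintype.card ι :=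
  (Finset.card_eq_sum_card_image K Finset.univ).symm

lemma IsTwoToOne.two_mul_card_image (h : IsTwoToOne K) :
    2 * #(Finset.univ.image K) = Fintype.card ι := by
  have hfiber : ∀ b ∈ Finset.univ.image K, #{i | K i = b} = 2 := by
    simpa using isTwoToOne_iff_card_fiber.1 h
  rw [← sum_card_fiber K, Finset.sum_congr rfl hfiber, Finset.sum_const, smul_eq_mul, mul_comm]

lemma exists_unique_or_two_mul_card_image_lt_or_isTwoToOne (K : ι → κ) :
    (∃ t, ∀ s, K s = K t → s = t) ∨ 2 * #(Finset.univ.image K) < Fintype.card ι ∨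
      IsTwoToOne K := by
  refine or_iff_not_imp_left.2 fun hrepeat => or_iff_not_imp_right.2 fun hnot => ?_
  push Not at hrepeat
  rw [isTwoToOne_iff_card_fiber] at hnot
  push Not at hnot
  obtain ⟨t, ht⟩ := hnot
  have htwo : ∀ b ∈ Finset.univ.image K, 2 ≤ #{i | K i = b} := by
    intro b hb
    obtain ⟨i, -, rfl⟩ := Finset.mem_image.1 hb
    obtain ⟨j, hj, hji⟩ := hrepeat i
    exact Finset.one_lt_card.2 ⟨j, by simpa using hj, i, by simp, hji⟩
  have hmem : K t ∈ Finset.univ.image K := Finset.mem_image_of_mem _ (Finset.mem_univ _)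
  have hlt := Finset.sum_lt_sum htwo ⟨K t, hmem, (htwo _ hmem).lt_of_ne ht.symm⟩
  rw [sum_card_fiber] at hlt
  simpa [mul_comm] using hlt

end Fintype

section FiberMinima

variable [Fintype ι] [LinearOrder ι] [DecidableEq κ]

lemma mem_fiberMinima {i : ι} : i ∈ fiberMinima K ↔ ∀ j, K j = K i → i ≤ j := by
  simp [fiberMinima]

lemma injOn_fiberMinima : Set.InjOn K (fiberMinima K) := fun i hi j hj hij =>
  le_antisymm (mem_fiberMinima.1 hi j hij.symm) (mem_fiberMinima.1 hj i hij)

lemma exists_mem_fiberMinima_eq (K : ι → κ) (i : ι) : ∃ a ∈ fiberMinima K, K a = K i := by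
  obtain ⟨a, ha, hmin⟩ :=
    Finset.exists_min_image (Finset.univ.filter fun l => K l = K i) id ⟨i, by simp⟩
  replace ha : K a = K i := by simpa using ha
  exact ⟨a, mem_fiberMinima.2 fun j hj => hmin j (by simpa using hj.trans ha), ha⟩

lemma card_fiberMinima (K : ι → κ) : #(fiberMinima K) = #(Finset.univ.image K) := by
  rw [← Finset.card_image_of_injOn injOn_fiberMinima]
  congr 1
  refine (Finset.image_subset_image (Finset.subset_univ _)).antisymm fun b hb => ?_
  obtain ⟨i, -, rfl⟩ := Finset.mem_image.1 hb
  exact Finset.mem_image.2 (exists_mem_fiberMinima_eq K i)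

lemma existsUnique_fiberMinima_orderEmbOfFin {k : ℕ} (hcard : #(fiberMinima K) = k) (i : ι) :
    ∃! t, K i = K ((fiberMinima K).orderEmbOfFin hcard t) := by
  obtain ⟨a, ha, hai⟩ := exists_mem_fiberMinima_eq K i
  obtain ⟨t, rfl⟩ : a ∈ Set.range ((fiberMinima K).orderEmbOfFin hcard) := by
    rwa [Finset.range_orderEmbOfFin]
  refine ⟨t, hai.symm, fun t' ht' => ((fiberMinima K).orderEmbOfFin hcard).injective ?_⟩
  exact injOn_fiberMinima (Finset.orderEmbOfFin_mem _ _ _) (Finset.orderEmbOfFin_mem _ _ _)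
    (ht'.symm.trans hai.symm)

end FiberMinima

namespace PairPartition

/-- `K` takes equal values at the two points of each block. -/
def Matches {k : ℕ} (π : PairPartition k) (K : Fin (2 * k) → κ) : Prop :=
  ∀ t, K (π.r t) = K (π.s t)

variable {k : ℕ} {K : Fin (2 * k) → κ} {π π' : PairPartition k}

lemma Matches.eq_r_block (h : π.Matches K) (i : Fin (2 * k)) : K i = K (π.r (π.block i)) := by
  rcases π.block_spec i with hi | hi
  · exact congrArg K hi
  · exact (congrArg K hi).trans (h _).symm

lemma Matches.range_r [DecidableEq κ] (h : π.Matches K) (hK : IsTwoToOne K) :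
    Set.range π.r = fiberMinima K := by
  ext i
  rw [Finset.mem_coe, mem_fiberMinima]
  constructor
  · rintro ⟨t, rfl⟩ j hj
    rcases hK.eq_or_eq (π.r_ne_s t) (h t).symm hj with rfl | rfl
    exacts [le_rfl, (π.r_lt_s t).le]
  · intro hmin
    rcases π.block_spec i with hi | hi
    · exact ⟨_, hi.symm⟩
    · have hle : π.s (π.block i) ≤ π.r (π.block i) := by
        simpa only [← hi] using hmin _ (h.eq_r_block i).symm
      exact absurd hle (π.r_lt_s _).not_ge

lemma Matches.eq (h : π.Matches K) (h' : π'.Matches K) (hK : IsTwoToOne K) : π = π' := by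
  classical
  have hr : π.r = π'.r :=
    (π.r_strictMono.range_inj π'.r_strictMono).1 ((h.range_r hK).trans (h'.range_r hK).symm)
  refine PairPartition.ext hr (funext fun t => ?_)
  have hne : π.r t ≠ π'.s t := hr ▸ π'.r_ne_s t
  have hKs : K (π'.s t) = K (π.r t) := by rw [hr, h' t]
  exact (hK.eq_or_eq hne hKs (h t).symm).resolve_left (π.r_ne_s t).symm

end PairPartition

lemma IsTwoToOne.exists_matches {k : ℕ} {K : Fin (2 * k) → κ} (hK : IsTwoToOne K) :
    ∃ π : PairPartition k, π.Matches K := by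
  classical
  have hcard : #(fiberMinima K) = k := by
    have := hK.two_mul_card_image
    rw [Fintype.card_fin] at this
    rw [card_fiberMinima]
    lia
  choose σ hσ_ne hσ using hK
  have hσ_eq : ∀ i, K (σ i) = K i := fun i => (hσ i _).2 (Or.inr rfl)
  let r := (fiberMinima K).orderEmbOfFin hcard
  have hr : ∀ t j, K j = K (r t) → r t ≤ j := fun t =>
    mem_fiberMinima.1 (Finset.orderEmbOfFin_mem _ hcard t)
  refine ⟨⟨r, fun t => σ (r t), r.strictMono,
    fun t => (hr t _ (hσ_eq _)).lt_of_ne (hσ_ne _).symm, fun i => ?_⟩, fun t => (hσ_eq _).symm⟩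
  simpa only [hσ] using existsUnique_fiberMinima_orderEmbOfFin hcard i

/-- The mixed moment prescribed by Wick's formula for centred variables with labels `K` and
covariances `c`: the sum over the pair partitions that match equal labels. -/
noncomputable def wickSum [DecidableEq κ] {k : ℕ} (K : Fin (2 * k) → κ)
    (c : Fin (2 * k) → Fin (2 * k) → ℂ) : ℂ :=
  ∑ π : PairPartition k, ∏ t, if K (π.r t) = K (π.s t) then c (π.r t) (π.s t) else 0

section WickSum

variable [DecidableEq κ] {k : ℕ} {K : Fin (2 * k) → κ}

lemma wickSum_eq_zero (c : Fin (2 * k) → Fin (2 * k) → ℂ) (h : ∃ t, ∀ s, K s = K t → s = t) :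
    wickSum K c = 0 := by
  obtain ⟨i, hi⟩ := h
  refine Finset.sum_eq_zero fun π _ => Finset.prod_eq_zero (Finset.mem_univ (π.block i)) ?_
  refine if_neg fun hK => π.r_ne_s (π.block i) ?_
  rcases π.block_spec i with h' | h'
  · rw [← h'] at hK ⊢
    exact (hi _ hK.symm).symm
  · rw [← h'] at hK ⊢
    exact hi _ hK

lemma wickSum_eq_prod (c : Fin (2 * k) → Fin (2 * k) → ℂ) (hK : IsTwoToOne K)
    {π : PairPartition k} (hπ : π.Matches K) : wickSum K c = ∏ t, c (π.r t) (π.s t) := by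
  rw [wickSum, Finset.sum_eq_single π]
  · exact Finset.prod_congr rfl fun t _ => if_pos (hπ t)
  · intro π' _ hne
    obtain ⟨t, ht⟩ := not_forall.1 fun hπ' : π'.Matches K => hne (hπ'.eq hπ hK)
    exact Finset.prod_eq_zero (Finset.mem_univ t) (if_neg ht)
  · exact fun h => absurd (Finset.mem_univ π) h

lemma norm_wickSum_le (K : Fin (2 * k) → κ) {c : Fin (2 * k) → Fin (2 * k) → ℂ} {C : ℝ}
    (hc : ∀ i j, ‖c i j‖ ≤ C) (hC : 0 ≤ C) :
    ‖wickSum K c‖ ≤ Fintype.card (PairPartition k) * C ^ k := by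
  have hterm : ∀ π : PairPartition k,
      ‖∏ t, if K (π.r t) = K (π.s t) then c (π.r t) (π.s t) else 0‖ ≤ C ^ k := fun π =>
    calc ‖∏ t, if K (π.r t) = K (π.s t) then c (π.r t) (π.s t) else 0‖
        = ∏ t, ‖if K (π.r t) = K (π.s t) then c (π.r t) (π.s t) else 0‖ := norm_prod _ _
      _ ≤ ∏ _t : Fin k, C := by
        refine Finset.prod_le_prod (fun _ _ => norm_nonneg _) fun t _ => ?_
        split_ifs
        exacts [hc _ _, by simpa using hC]
      _ = C ^ k := by simp
  calc ‖wickSum K c‖ ≤ ∑ _π : PairPartition k, C ^ k := norm_sum_le_of_le _ fun π _ => hterm π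
    _ = Fintype.card (PairPartition k) * C ^ k := by simp

end WickSum

end Fibers

section Independence

variable {ι κ Ω E 𝕜 : Type*} [Fintype ι] [RCLike 𝕜] [MeasurableSpace Ω] {P : Measure Ω}
  [MeasurableSpace E] {Z : κ → Ω → E} {F : ι → E → 𝕜}

lemma integral_prod_eq_prod_fibers [DecidableEq κ] (hZ : iIndepFun Z P)
    (mZ : ∀ b, Measurable (Z b)) (mF : ∀ t, Measurable (F t)) (K : ι → κ) :
    ∫ ω, ∏ t, F t (Z (K t) ω) ∂P =
      ∏ b ∈ Finset.univ.image K, ∫ ω, ∏ t with K t = b, F t (Z b ω) ∂P := by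
  have hfiber : ∀ ω, ∏ t, F t (Z (K t) ω) =
      ∏ b : Finset.univ.image K, ∏ t with K t = b, F t (Z b ω) := by
    intro ω
    rw [Finset.prod_coe_sort (Finset.univ.image K) (fun b => ∏ t with K t = b, F t (Z b ω)),
      ← Finset.prod_fiberwise_of_maps_to (t := Finset.univ.image K)
        fun t _ => Finset.mem_image_of_mem K (Finset.mem_univ t)]
    refine Finset.prod_congr rfl fun b _ => Finset.prod_congr rfl fun t ht => ?_
    rw [(Finset.mem_filter.1 ht).2]
  have hindep : iIndepFun (fun b : Finset.univ.image K => Z b) P :=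
    hZ.precomp Subtype.val_injective
  simp_rw [hfiber]
  rw [← Finset.prod_coe_sort (Finset.univ.image K)
    fun b => ∫ ω, ∏ t with K t = b, F t (Z b ω) ∂P]
  exact hindep.integral_fun_prod_comp
    (f := fun (b : Finset.univ.image K) (e : E) => ∏ t with K t = b, F t e)
    (fun b => (mZ b).aemeasurable)
    fun b => (Finset.measurable_fun_prod _ fun t _ => mF t).aestronglyMeasurable

lemma integral_prod_eq_zero_of_unique (hZ : iIndepFun Z P) (mZ : ∀ b, Measurable (Z b))
    (mF : ∀ t, Measurable (F t)) {K : ι → κ} {t : ι} (ht : ∀ s, K s = K t → s = t)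
    (hF : ∫ ω, F t (Z (K t) ω) ∂P = 0) : ∫ ω, ∏ s, F s (Z (K s) ω) ∂P = 0 := by
  classical
  rw [integral_prod_eq_prod_fibers hZ mZ mF]
  refine Finset.prod_eq_zero (Finset.mem_image_of_mem K (Finset.mem_univ t)) ?_
  have hfiber : (Finset.univ.filter fun s => K s = K t) = {t} := by
    ext s
    simpa using ⟨ht s, congrArg K⟩
  simpa only [hfiber, Finset.prod_singleton] using hF

lemma integral_prod_eq_prod_pairs {k : ℕ} {F : Fin (2 * k) → E → 𝕜} {K : Fin (2 * k) → κ}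
    (hZ : iIndepFun Z P) (mZ : ∀ b, Measurable (Z b)) (mF : ∀ t, Measurable (F t))
    (hK : IsTwoToOne K) {π : PairPartition k} (hπ : π.Matches K) :
    ∫ ω, ∏ t, F t (Z (K t) ω) ∂P =
      ∏ t, ∫ ω, F (π.r t) (Z (K (π.r t)) ω) * F (π.s t) (Z (K (π.r t)) ω) ∂P := by
  classical
  rw [integral_prod_eq_prod_fibers hZ mZ mF]
  have hfiber : ∀ t, (Finset.univ.filter fun i => K i = K (π.r t)) = {π.r t, π.s t} := by
    intro t
    ext i
    simp only [Finset.mem_filter, Finset.mem_univ, true_and, Finset.mem_insert,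
      Finset.mem_singleton]
    refine ⟨hK.eq_or_eq (π.r_ne_s t) (hπ t).symm, ?_⟩
    rintro (rfl | rfl)
    exacts [rfl, (hπ t).symm]
  symm
  refine Finset.prod_bij (fun t _ => K (π.r t))
    (fun t _ => Finset.mem_image_of_mem _ (Finset.mem_univ _)) (fun t _ t' _ htt' => ?_)
    (fun b hb => ?_) fun t _ => ?_
  · have hmem : π.r t' ∈ Finset.univ.filter fun i => K i = K (π.r t) := by simpa using htt'.symm
    rw [hfiber, Finset.mem_insert, Finset.mem_singleton] at hmem
    exact (π.block_eq hmem).symm.trans (π.block_r t')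
  · obtain ⟨i, -, rfl⟩ := Finset.mem_image.1 hb
    exact ⟨π.block i, Finset.mem_univ _, (hπ.eq_r_block i).symm⟩
  · simp_rw [hfiber, Finset.prod_pair (π.r_ne_s t)]

lemma prod_le_sum_pow_card [Nonempty ι] {f : ι → ℝ} (hf : ∀ t, 0 ≤ f t) :
    ∏ t, f t ≤ ∑ t, f t ^ Fintype.card ι := by
  obtain ⟨t₀, ht₀⟩ := Finite.exists_max f
  calc ∏ t, f t ≤ ∏ _t : ι, f t₀ :=
        Finset.prod_le_prod (fun t _ => hf t) fun t _ => ht₀ t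
    _ = f t₀ ^ Fintype.card ι := by simp
    _ ≤ ∑ t, f t ^ Fintype.card ι :=
        Finset.single_le_sum (f := fun t => f t ^ Fintype.card ι)
          (fun t _ => pow_nonneg (hf t) _) (Finset.mem_univ t₀)

lemma integrable_prod_and_norm_integral_prod_le [IsProbabilityMeasure P] {f : ι → Ω → 𝕜}
    (mf : ∀ t, Measurable (f t)) {C : ℝ}
    (h : ∀ t, Integrable (fun ω => ‖f t ω‖ ^ Fintype.card ι) P ∧
      ∫ ω, ‖f t ω‖ ^ Fintype.card ι ∂P ≤ C) :
    Integrable (fun ω => ∏ t, f t ω) P ∧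
      ‖∫ ω, ∏ t, f t ω ∂P‖ ≤ 1 + Fintype.card ι * C := by
  rcases isEmpty_or_nonempty ι with hι | hι
  · simp
  have hint : Integrable (fun ω => ∑ t, ‖f t ω‖ ^ Fintype.card ι) P :=
    integrable_finsetSum _ fun t _ => (h t).1
  have hle : ∀ ω, ‖∏ t, f t ω‖ ≤ ∑ t, ‖f t ω‖ ^ Fintype.card ι := fun ω => by
    rw [norm_prod]
    exact prod_le_sum_pow_card fun t => norm_nonneg _
  refine ⟨hint.mono' (Finset.measurable_fun_prod _ fun t _ => mf t).aestronglyMeasurable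
    (ae_of_all _ hle), ?_⟩
  calc ‖∫ ω, ∏ t, f t ω ∂P‖
      ≤ ∫ ω, ∑ t, ‖f t ω‖ ^ Fintype.card ι ∂P := norm_integral_le_of_norm_le hint (ae_of_all _ hle)
    _ = ∑ t, ∫ ω, ‖f t ω‖ ^ Fintype.card ι ∂P := integral_finsetSum _ fun t _ => (h t).1
    _ ≤ ∑ _t : ι, C := Finset.sum_le_sum fun t _ => (h t).2
    _ = Fintype.card ι * C := by simp
    _ ≤ 1 + Fintype.card ι * C := by linarith

end Independence

section Inputs

/-- The entry `a ^ ε` (for `c = true`) or `b ^ ε` (for `c = false`) of an input pair `(a, b)`. -/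
noncomputable def entry (ε : StarExp) (c : Bool) (e : ℂ × ℂ) : ℂ :=
  ε.app (if c then e.1 else e.2)

/-- The covariance of two entries that use the same input pair. -/
noncomputable def entryCov (ρ : Correlations) (ε : StarExp) (c : Bool) (ε' : StarExp) (c' : Bool) :
    ℂ :=
  match c, c' with
  | true, true => ((ε.sign : ℂ) * 2 * Complex.I * (ρ.ρ₁ : ℂ)) ^ kron ε ε'
  | false, false => ((ε.sign : ℂ) * 2 * Complex.I * (ρ.ρ₅ : ℂ)) ^ kron ε ε'
  | true, false => mixedCoeff ρ ε.sign (kron ε ε')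
  | false, true => mixedCoeff ρ ε'.sign (kron ε ε')

lemma measurable_entry (ε : StarExp) (c : Bool) : Measurable (entry ε c) := by
  cases ε <;> cases c
  exacts [measurable_snd, measurable_fst, continuous_star.measurable.comp measurable_snd,
    continuous_star.measurable.comp measurable_fst]

lemma norm_entry (ε : StarExp) (c : Bool) (e : ℂ × ℂ) :
    ‖entry ε c e‖ = ‖if c then e.1 else e.2‖ := by
  cases ε <;> simp [entry, StarExp.app]

section ToComplex

variable {Ω : Type*} {f g : Ω → ℝ}

lemma entry_toComplex (ε : StarExp) (c : Bool) (x y u v : Ω → ℝ) (ω : Ω) :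
    entry ε c (toComplex x y ω, toComplex u v ω) =
      ((if c then x ω else u ω : ℝ) : ℂ) +
        (ε.sign : ℂ) * Complex.I * ((if c then y ω else v ω : ℝ) : ℂ) := by
  cases ε <;> cases c <;> simp [entry, StarExp.app, StarExp.sign, toComplex]

lemma norm_toComplex_sq (f g : Ω → ℝ) (ω : Ω) : ‖toComplex f g ω‖ ^ 2 = f ω ^ 2 + g ω ^ 2 := by
  rw [← Complex.normSq_eq_norm_sq, toComplex, mul_comm, Complex.normSq_add_mul_I]

lemma norm_toComplex_le (f g : Ω → ℝ) (ω : Ω) : ‖toComplex f g ω‖ ≤ |f ω| + |g ω| :=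
  (norm_add_le _ _).trans_eq (by simp)

variable [MeasurableSpace Ω] {P : Measure Ω}

lemma measurable_toComplex (mf : Measurable f) (mg : Measurable g) :
    Measurable (toComplex f g) := by
  unfold toComplex
  fun_prop

lemma integral_mul_self_eq_half (hf : MemLp f 2 P) (hg : MemLp g 2 P)
    (hvar : ∫ ω, ‖toComplex f g ω‖ ^ 2 ∂P = 1) (hbal : ∫ ω, f ω ^ 2 ∂P = ∫ ω, g ω ^ 2 ∂P) :
    ∫ ω, f ω * f ω ∂P = 1 / 2 ∧ ∫ ω, g ω * g ω ∂P = 1 / 2 := by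
  simp_rw [norm_toComplex_sq] at hvar
  rw [integral_add hf.integrable_sq hg.integrable_sq] at hvar
  simp_rw [← pow_two]
  constructor <;> linarith

lemma integral_norm_toComplex_pow_le (mf : Measurable f) (mg : Measurable g) {q : ℕ} {C : ℝ}
    (hf : Integrable (fun ω => |f ω| ^ q) P ∧ ∫ ω, |f ω| ^ q ∂P ≤ C)
    (hg : Integrable (fun ω => |g ω| ^ q) P ∧ ∫ ω, |g ω| ^ q ∂P ≤ C) :
    Integrable (fun ω => ‖toComplex f g ω‖ ^ q) P ∧
      ∫ ω, ‖toComplex f g ω‖ ^ q ∂P ≤ 2 ^ (q - 1) * (C + C) := by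
  have hle : ∀ ω, ‖toComplex f g ω‖ ^ q ≤ 2 ^ (q - 1) * (|f ω| ^ q + |g ω| ^ q) := fun ω =>
    (pow_le_pow_left₀ (norm_nonneg _) (norm_toComplex_le f g ω) q).trans
      (add_pow_le (abs_nonneg _) (abs_nonneg _) q)
  have hdom : Integrable (fun ω => 2 ^ (q - 1) * (|f ω| ^ q + |g ω| ^ q)) P :=
    (hf.1.add hg.1).const_mul _
  have hint : Integrable (fun ω => ‖toComplex f g ω‖ ^ q) P :=
    hdom.mono' ((measurable_toComplex mf mg).norm.pow_const q).aestronglyMeasurable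
      (ae_of_all _ fun ω => (Real.norm_of_nonneg (by positivity)).trans_le (hle ω))
  refine ⟨hint, ?_⟩
  calc ∫ ω, ‖toComplex f g ω‖ ^ q ∂P
      ≤ ∫ ω, 2 ^ (q - 1) * (|f ω| ^ q + |g ω| ^ q) ∂P := integral_mono hint hdom hle
    _ = 2 ^ (q - 1) * (∫ ω, |f ω| ^ q ∂P + ∫ ω, |g ω| ^ q ∂P) := by
        rw [integral_const_mul, integral_add hf.1 hg.1]
    _ ≤ 2 ^ (q - 1) * (C + C) := by gcongr <;> [exact hf.2; exact hg.2]

lemma integral_add_I_mul_mul_add_I_mul {p q p' q' : Ω → ℝ} (s s' : ℂ) (hp : MemLp p 2 P)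
    (hq : MemLp q 2 P) (hp' : MemLp p' 2 P) (hq' : MemLp q' 2 P) :
    ∫ ω, ((p ω : ℂ) + s * Complex.I * (q ω : ℂ)) * ((p' ω : ℂ) + s' * Complex.I * (q' ω : ℂ)) ∂P =
      ((∫ ω, p ω * p' ω ∂P : ℝ) : ℂ) - s * s' * ((∫ ω, q ω * q' ω ∂P : ℝ) : ℂ) +
        Complex.I * (s' * ((∫ ω, p ω * q' ω ∂P : ℝ) : ℂ) + s * ((∫ ω, q ω * p' ω ∂P : ℝ) : ℂ)) := by
  have hexpand : ∀ ω, ((p ω : ℂ) + s * Complex.I * (q ω : ℂ)) *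
      ((p' ω : ℂ) + s' * Complex.I * (q' ω : ℂ)) =
      ((p ω * p' ω : ℝ) : ℂ) + (-(s * s')) * ((q ω * q' ω : ℝ) : ℂ) +
        ((Complex.I * s') * ((p ω * q' ω : ℝ) : ℂ) + (Complex.I * s) * ((q ω * p' ω : ℝ) : ℂ)) := by
    intro ω
    push_cast
    linear_combination (s * s' * q ω * q' ω : ℂ) * Complex.I_sq
  have hint : ∀ {f g : Ω → ℝ}, MemLp f 2 P → MemLp g 2 P → ∀ c : ℂ,
      Integrable (fun ω => c * ((f ω * g ω : ℝ) : ℂ)) P :=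
    fun hf hg c => (hf.integrable_mul hg).ofReal.const_mul c
  have hpp' : Integrable (fun ω => ((p ω * p' ω : ℝ) : ℂ)) P := (hp.integrable_mul hp').ofReal
  have hsplit := (integral_add (hpp'.add (hint hq hq' (-(s * s'))))
    ((hint hp hq' (Complex.I * s')).add (hint hq hp' (Complex.I * s)))).trans
    (congrArg₂ (· + ·) (integral_add hpp' (hint hq hq' _))
      (integral_add (hint hp hq' _) (hint hq hp' _)))
  simp_rw [integral_const_mul, integral_complex_ofReal] at hsplit
  simp_rw [hexpand]
  refine hsplit.trans ?_
  ring

end ToComplex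

namespace InputAssumption

variable {Ω : ℕ → Type*} [∀ n, MeasurableSpace (Ω n)] {P : ∀ n, Measure (Ω n)}
  {ρ : Correlations} {x y u v : ∀ n, ℤ → Ω n → ℝ}

lemma measurable_pair (h : InputAssumption P ρ x y u v) (n : ℕ) (j : ℤ) :
    Measurable fun ω => (toComplex (x n j) (y n j) ω, toComplex (u n j) (v n j) ω) :=
  (measurable_toComplex (h.measurable_x n j) (h.measurable_y n j)).prodMk
    (measurable_toComplex (h.measurable_u n j) (h.measurable_v n j))

lemma integral_entry (h : InputAssumption P ρ x y u v) (n : ℕ) (ε : StarExp) (c : Bool) (j : ℤ) :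
    ∫ ω, entry ε c (toComplex (x n j) (y n j) ω, toComplex (u n j) (v n j) ω) ∂P n = 0 := by
  cases ε <;> cases c <;>
    simp only [entry, StarExp.app, if_true, Bool.false_eq_true, if_false]
  · exact h.mean_b n j
  · exact h.mean_a n j
  · exact integral_conj.trans (by rw [h.mean_b n j, map_zero])
  · exact integral_conj.trans (by rw [h.mean_a n j, map_zero])

lemma memLp_two (h : InputAssumption P ρ x y u v) (n : ℕ) (j : ℤ) :
    MemLp (x n j) 2 (P n) ∧ MemLp (y n j) 2 (P n) ∧ MemLp (u n j) 2 (P n) ∧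
      MemLp (v n j) 2 (P n) := by
  obtain ⟨C, hC⟩ := h.moments
  obtain ⟨⟨hx, -⟩, ⟨hy, -⟩, ⟨hu, -⟩, ⟨hv, -⟩⟩ := hC 2 one_le_two n j
  simp only [sq_abs] at hx hy hu hv
  exact ⟨(memLp_two_iff_integrable_sq (h.measurable_x n j).aestronglyMeasurable).2 hx,
    (memLp_two_iff_integrable_sq (h.measurable_y n j).aestronglyMeasurable).2 hy,
    (memLp_two_iff_integrable_sq (h.measurable_u n j).aestronglyMeasurable).2 hu,
    (memLp_two_iff_integrable_sq (h.measurable_v n j).aestronglyMeasurable).2 hv⟩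

lemma integral_entry_mul_entry (h : InputAssumption P ρ x y u v) (n : ℕ) (ε ε' : StarExp)
    (c c' : Bool) (j : ℤ) :
    ∫ ω, entry ε c (toComplex (x n j) (y n j) ω, toComplex (u n j) (v n j) ω) *
      entry ε' c' (toComplex (x n j) (y n j) ω, toComplex (u n j) (v n j) ω) ∂P n =
      entryCov ρ ε c ε' c' := by
  obtain ⟨hx, hy, hu, hv⟩ := h.memLp_two n j
  obtain ⟨hxx, hyy⟩ := integral_mul_self_eq_half hx hy (h.variance_a n j) (h.balanced_a n j)
  obtain ⟨huu, hvv⟩ := integral_mul_self_eq_half hu hv (h.variance_b n j) (h.balanced_b n j)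
  have hcomm : ∀ f g : Ω n → ℝ, ∫ ω, f ω * g ω ∂P n = ∫ ω, g ω * f ω ∂P n :=
    fun f g => integral_congr_ae (ae_of_all _ fun ω => mul_comm _ _)
  simp_rw [entry_toComplex]
  cases c <;> cases c' <;> simp only [if_true, Bool.false_eq_true, if_false]
  · rw [integral_add_I_mul_mul_add_I_mul _ _ hu hv hu hv, huu, hvv, hcomm (v n j), h.corr₅]
    cases ε <;> cases ε' <;> simp [entryCov, StarExp.sign, kron] <;> ring
  · rw [integral_add_I_mul_mul_add_I_mul _ _ hu hv hx hy, hcomm (u n j) (x n j), h.corr₂,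
      hcomm (v n j) (y n j), h.corr₆, h.corr₄, hcomm (v n j) (x n j), h.corr₃]
    cases ε <;> cases ε' <;> simp [entryCov, mixedCoeff, StarExp.sign, kron] <;> ring
  · rw [integral_add_I_mul_mul_add_I_mul _ _ hx hy hu hv, h.corr₂, h.corr₆, h.corr₃,
      hcomm (y n j) (u n j), h.corr₄]
    cases ε <;> cases ε' <;> simp [entryCov, mixedCoeff, StarExp.sign, kron] <;> ring
  · rw [integral_add_I_mul_mul_add_I_mul _ _ hx hy hx hy, hxx, hyy, hcomm (y n j), h.corr₁]
    cases ε <;> cases ε' <;> simp [entryCov, StarExp.sign, kron] <;> ring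

lemma exists_moment_bound (h : InputAssumption P ρ x y u v) {q : ℕ} (hq : 1 ≤ q) :
    ∃ C : ℝ, ∀ n ε c j,
      Integrable (fun ω => ‖entry ε c (toComplex (x n j) (y n j) ω,
        toComplex (u n j) (v n j) ω)‖ ^ q) (P n) ∧
      ∫ ω, ‖entry ε c (toComplex (x n j) (y n j) ω,
        toComplex (u n j) (v n j) ω)‖ ^ q ∂P n ≤ C := by
  obtain ⟨C, hC⟩ := h.moments
  refine ⟨2 ^ (q - 1) * (C q + C q), fun n ε c j => ?_⟩
  obtain ⟨hx, hy, hu, hv⟩ := hC q hq n j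
  simp_rw [norm_entry]
  cases c
  · exact integral_norm_toComplex_pow_le (h.measurable_u n j) (h.measurable_v n j) hu hv
  · exact integral_norm_toComplex_pow_le (h.measurable_x n j) (h.measurable_y n j) hx hy

end InputAssumption

end Inputs

section WordExpansion

variable {ι R : Type*} [Fintype ι]

lemma list_prod_mulVec_apply [DecidableEq ι] [CommSemiring R] {p : ℕ} (A : Fin p → Matrix ι ι R)
    (x : ι → R) (i : ι) :
    (List.ofFn A).prod.mulVec x i = ∑ w : Fin p → ι,
      (∏ t, A t (Fin.cons (α := fun _ => ι) i w t.castSucc) (w t)) *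
        x (Fin.cons (α := fun _ => ι) i w (Fin.last p)) := by
  induction p generalizing i with
  | zero => simp
  | succ p ih =>
    rw [List.ofFn_succ, List.prod_cons, ← Matrix.mulVec_mulVec, Matrix.mulVec, dotProduct,
      ← (Fin.consEquiv fun _ : Fin (p + 1) => ι).sum_comp, Fintype.sum_prod_type]
    refine Finset.sum_congr rfl fun j _ => ?_
    simp only [ih, Finset.mul_sum, Fin.consEquiv_apply, Fin.prod_univ_succ, Fin.castSucc_zero,
      ← Fin.succ_castSucc, ← Fin.succ_last, Fin.cons_zero, Fin.cons_succ, mul_assoc]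

/-- The closed index paths of length `p` in `ι`. -/
def closedPaths (ι : Type*) [Fintype ι] [DecidableEq ι] (p : ℕ) : Finset (Fin (p + 1) → ι) :=
  {w | w 0 = w (Fin.last p)}

lemma trace_list_prod [DecidableEq ι] [CommSemiring R] {p : ℕ} (A : Fin p → Matrix ι ι R) :
    (List.ofFn A).prod.trace =
      ∑ w ∈ closedPaths ι p, ∏ t : Fin p, A t (w t.castSucc) (w t.succ) := by
  have hdiag : ∀ i, (List.ofFn A).prod i i = (List.ofFn A).prod.mulVec (Pi.single i 1) i := by
    simp
  rw [Matrix.trace, closedPaths, Finset.sum_filter,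
    ← (Fin.consEquiv fun _ : Fin (p + 1) => ι).sum_comp, Fintype.sum_prod_type]
  simp only [Matrix.diag_apply, hdiag, list_prod_mulVec_apply, Fin.consEquiv_apply, Fin.cons_zero,
    Fin.cons_succ, Pi.single_apply, mul_ite, mul_one, mul_zero, eq_comm]

end WordExpansion

section HankelPaths

variable {n p m : ℕ}

/-- The index of the input in position `(i, j)` of a Hankel matrix; the paper's `n + 1 - i - j`,
with rows and columns numbered from `0`. -/
def hankelIndex (i j : Fin n) : ℤ := (n : ℤ) - 1 - i - j

/-- Whether the entry in position `(i, j)` of `H ^ ε` is an `a`-entry. -/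
def isAEntry (ε : StarExp) (i j : Fin n) : Bool :=
  match ε with
  | .one => decide (j < i)
  | .star => decide (i < j)

/-- The entry that a path picks from the `t`-th factor of a word, as a function of the input pair
that it uses. -/
noncomputable def pathEntry (ε : Fin p → StarExp) (w : Fin (p + 1) → Fin n) (t : Fin p) :
    ℂ × ℂ → ℂ :=
  entry (ε t) (isAEntry (ε t) (w t.castSucc) (w t.succ))

/-- The input pair that a path uses in the `t`-th factor of a word: its matrix and its index. -/
def pathInput (τ : Fin p → Fin m) (w : Fin (p + 1) → Fin n) (t : Fin p) : Fin m × ℤ :=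
  (τ t, hankelIndex (w t.castSucc) (w t.succ))

/-- The covariance of the entries that a path picks from the factors `i` and `j`, if these use the
same input pair. -/
noncomputable def pathCov (ρ : Correlations) (ε : Fin p → StarExp) (w : Fin (p + 1) → Fin n)
    (i j : Fin p) : ℂ :=
  entryCov ρ (ε i) (isAEntry (ε i) (w i.castSucc) (w i.succ)) (ε j)
    (isAEntry (ε j) (w j.castSucc) (w j.succ))

/-- The matrix `n^{-1/2} H_n^{(i)}` whose input pairs are the values of `Z` on `{i} × ℤ`. -/
noncomputable def normalizedHankel (n : ℕ) (Z : Fin m × ℤ → ℂ × ℂ) (i : Fin m) :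
    Matrix (Fin n) (Fin n) ℂ :=
  (((Real.sqrt n)⁻¹ : ℝ) : ℂ) • hankel n (fun j => (Z (i, j)).1) (fun j => (Z (i, j)).2)

lemma hankel_apply (a b : ℤ → ℂ) (i j : Fin n) :
    hankel n a b i j = if j < i then a (hankelIndex i j) else b (hankelIndex i j) := by
  have hrev : hankel n a b i j = genToeplitz n a b (Fin.rev i) j := by
    simp [hankel, backwardIdentity, Matrix.mul_apply]
  have hindex : ((Fin.rev i).val : ℤ) - (j.val : ℤ) = hankelIndex i j := by
    have := i.isLt
    simp only [hankelIndex, Fin.val_rev]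
    omega
  rw [hrev, genToeplitz, Matrix.of_apply, hindex]
  refine if_congr ?_ rfl rfl
  have := i.isLt
  rw [Fin.lt_def, Fin.val_rev]
  omega

lemma app_hankel_apply (ε : StarExp) (a b : ℤ → ℂ) (i j : Fin n) :
    (ε.app (hankel n a b)) i j =
      entry ε (isAEntry ε i j) (a (hankelIndex i j), b (hankelIndex i j)) := by
  cases ε
  · simp [StarExp.app, hankel_apply, entry, isAEntry]
  · have hsymm : hankelIndex j i = hankelIndex i j := by
      simp only [hankelIndex]
      ring
    simp only [StarExp.app, Matrix.star_apply, hankel_apply, entry, isAEntry, hsymm,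
      decide_eq_true_eq]

lemma app_normalizedHankel_apply (ε : StarExp) (Z : Fin m × ℤ → ℂ × ℂ) (l : Fin m) (i j : Fin n) :
    ε.app (normalizedHankel n Z l) i j =
      (((Real.sqrt n)⁻¹ : ℝ) : ℂ) * entry ε (isAEntry ε i j) (Z (l, hankelIndex i j)) := by
  rw [← Prod.mk.eta (p := Z (l, hankelIndex i j)),
    ← app_hankel_apply ε (fun j => (Z (l, j)).1) fun j => (Z (l, j)).2]
  cases ε <;> simp [StarExp.app, normalizedHankel]

lemma trace_starWord (τ : Fin p → Fin m) (ε : Fin p → StarExp) (Z : Fin m × ℤ → ℂ × ℂ) :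
    (starWord (normalizedHankel n Z) τ ε).trace = (((Real.sqrt n)⁻¹ : ℝ) : ℂ) ^ p *
      ∑ w ∈ closedPaths (Fin n) p, ∏ t, pathEntry ε w t (Z (pathInput τ w t)) := by
  rw [starWord, trace_list_prod, Finset.mul_sum]
  simp only [app_normalizedHankel_apply, Finset.prod_mul_distrib, Finset.prod_const,
    Finset.card_univ, Fintype.card_fin, pathEntry, pathInput]

lemma integrable_trace_starWord {Ω : Type*} [MeasurableSpace Ω] {P : Measure Ω} (τ : Fin p → Fin m)
    (ε : Fin p → StarExp) {Z : Fin m × ℤ → Ω → ℂ × ℂ}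
    (hZ : ∀ w : Fin (p + 1) → Fin n,
      Integrable (fun ω => ∏ t, pathEntry ε w t (Z (pathInput τ w t) ω)) P) :
    Integrable (fun ω => (starWord (normalizedHankel n fun b => Z b ω) τ ε).trace) P := by
  simp_rw [trace_starWord]
  exact (integrable_finsetSum _ fun w _ => hZ w).const_mul _

lemma expTrace_starWord {Ω : Type*} [MeasurableSpace Ω] {P : Measure Ω} (τ : Fin p → Fin m)
    (ε : Fin p → StarExp) {Z : Fin m × ℤ → Ω → ℂ × ℂ}
    (hZ : ∀ w : Fin (p + 1) → Fin n,
      Integrable (fun ω => ∏ t, pathEntry ε w t (Z (pathInput τ w t) ω)) P) :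
    expTrace P (fun ω => starWord (normalizedHankel n fun b => Z b ω) τ ε) =
      (n : ℂ)⁻¹ * (((Real.sqrt n)⁻¹ : ℝ) : ℂ) ^ p *
        ∑ w ∈ closedPaths (Fin n) p, ∫ ω, ∏ t, pathEntry ε w t (Z (pathInput τ w t) ω) ∂P := by
  simp_rw [expTrace, trace_starWord]
  rw [integral_const_mul, integral_finsetSum _ fun w _ => hZ w, mul_assoc]

lemma path_ext {w w' : Fin (p + 1) → Fin n} (hlast : w (Fin.last p) = w' (Fin.last p))
    (hindex : ∀ t : Fin p, hankelIndex (w t.castSucc) (w t.succ) =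
      hankelIndex (w' t.castSucc) (w' t.succ)) : w = w' := by
  funext i
  induction i using Fin.reverseInduction with
  | last => exact hlast
  | cast i ih =>
    have hi := hindex i
    simp only [hankelIndex, ih] at hi
    exact Fin.ext (by omega)

lemma hankelIndex_mem (i j : Fin n) : hankelIndex i j ∈ Finset.Icc (-(n : ℤ)) n := by
  have := i.isLt
  have := j.isLt
  rw [Finset.mem_Icc, hankelIndex]
  constructor <;> omega

end HankelPaths

section Counting

variable {p m : ℕ}

lemma card_filter_card_image_le {ι α : Type*} [Fintype ι] [DecidableEq ι] [DecidableEq α]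
    {S : Finset α} {B : ℕ} (hB : B ≤ #S) :
    #{f ∈ Fintype.piFinset fun _ : ι => S | #(Finset.univ.image f) ≤ B} ≤
      (#S) ^ B * B ^ Fintype.card ι := by
  have hsub : {f ∈ Fintype.piFinset fun _ : ι => S | #(Finset.univ.image f) ≤ B} ⊆
      (Finset.powersetCard B S).biUnion fun s => Fintype.piFinset fun _ => s := by
    intro f hf
    obtain ⟨hfS, hfB⟩ := Finset.mem_filter.1 hf
    have himage : Finset.univ.image f ⊆ S :=
      Finset.image_subset_iff.2 fun t _ => Fintype.mem_piFinset.1 hfS t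
    obtain ⟨s, hfs, hsS, hs⟩ := Finset.exists_subsuperset_card_eq himage hfB hB
    exact Finset.mem_biUnion.2 ⟨s, Finset.mem_powersetCard.2 ⟨hsS, hs⟩,
      Fintype.mem_piFinset.2 fun t => hfs (Finset.mem_image_of_mem _ (Finset.mem_univ t))⟩
  calc #{f ∈ Fintype.piFinset fun _ : ι => S | #(Finset.univ.image f) ≤ B}
      ≤ #((Finset.powersetCard B S).biUnion fun s => Fintype.piFinset fun _ : ι => s) :=
        Finset.card_le_card hsub
    _ ≤ #(Finset.powersetCard B S) * B ^ Fintype.card ι :=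
        Finset.card_biUnion_le_card_mul _ _ _ fun s hs => by
          rw [Fintype.card_piFinset, Finset.prod_const, Finset.card_univ,
            (Finset.mem_powersetCard.1 hs).2]
    _ ≤ (#S) ^ B * B ^ Fintype.card ι := by
        rw [Finset.card_powersetCard]
        exact Nat.mul_le_mul_right _ (Nat.choose_le_pow _ _)

/-- The closed paths that use fewer than `p / 2` input pairs. Their number is of lower order than
the normalization `n ^ (1 + p / 2)`. -/
def degeneratePaths (n : ℕ) (τ : Fin p → Fin m) : Finset (Fin (p + 1) → Fin n) :=
  {w ∈ closedPaths (Fin n) p | 2 * #(Finset.univ.image (pathInput τ w)) < p}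

lemma card_degeneratePaths_le {n B : ℕ} (τ : Fin p → Fin m) (hB : p ≤ 2 * B + 2)
    (hBn : B ≤ 2 * n + 1) :
    #(degeneratePaths n τ) ≤ n * ((2 * n + 1) ^ B * B ^ p) := by
  have hIcc : #(Finset.Icc (-(n : ℤ)) n) = 2 * n + 1 := by
    rw [Int.card_Icc]
    lia
  have hindices := card_filter_card_image_le (ι := Fin p) (hBn.trans_eq hIcc.symm)
  rw [hIcc, Fintype.card_fin] at hindices
  refine le_trans (Finset.card_le_card_of_injOn
      (t := Finset.univ ×ˢ {f ∈ Fintype.piFinset fun _ : Fin p => Finset.Icc (-(n : ℤ)) n |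
        #(Finset.univ.image f) ≤ B})
      (fun w => (w (Fin.last p), fun t => hankelIndex (w t.castSucc) (w t.succ)))
      (fun w hw => ?_) fun w _ w' _ heq => ?_)
    (by rw [Finset.card_product, Finset.card_univ, Fintype.card_fin]
        exact Nat.mul_le_mul_left n hindices)
  · have hfew : 2 * #(Finset.univ.image (pathInput τ w)) < p := (Finset.mem_filter.1 hw).2
    have hsnd : Finset.univ.image (fun t : Fin p => hankelIndex (w t.castSucc) (w t.succ)) =
        (Finset.univ.image (pathInput τ w)).image Prod.snd := by
      rw [Finset.image_image]
      rfl
    have hle := Finset.card_image_le (s := Finset.univ.image (pathInput τ w)) (f := Prod.snd)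
    rw [← hsnd] at hle
    simp only [Finset.coe_product, Set.mem_prod, Finset.mem_coe, Finset.mem_univ, true_and,
      Finset.mem_filter, Fintype.mem_piFinset]
    exact ⟨fun t => hankelIndex_mem _ _, by lia⟩
  · simp only [Prod.mk.injEq] at heq
    exact path_ext heq.1 (congrFun heq.2)

lemma card_degeneratePaths_le_sqrt {n B : ℕ} (τ : Fin p → Fin m) (hB : p ≤ 2 * B + 2)
    (hBp : 2 * B + 1 ≤ p) (hn : 1 ≤ n) (hBn : B ≤ n) :
    (n : ℝ)⁻¹ * (Real.sqrt n)⁻¹ ^ p * #(degeneratePaths n τ) ≤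
      (3 ^ B * B ^ p) * (Real.sqrt n)⁻¹ := by
  have hn' : (1 : ℝ) ≤ n := by exact_mod_cast hn
  have hsqrt : 1 ≤ Real.sqrt n := Real.one_le_sqrt.2 hn'
  have hcard : (#(degeneratePaths n τ) : ℝ) ≤ n * ((3 * n) ^ B * B ^ p) := by
    calc (#(degeneratePaths n τ) : ℝ) ≤ ((n * ((2 * n + 1) ^ B * B ^ p) : ℕ) : ℝ) := by
          exact_mod_cast card_degeneratePaths_le τ hB (by lia)
      _ ≤ n * ((3 * n) ^ B * B ^ p) := by
          push_cast
          gcongr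
          linarith
  have hpow : (Real.sqrt n)⁻¹ ^ p ≤ (Real.sqrt n)⁻¹ ^ (2 * B + 1) :=
    pow_le_pow_of_le_one (by positivity) (inv_le_one_of_one_le₀ hsqrt) hBp
  calc (n : ℝ)⁻¹ * (Real.sqrt n)⁻¹ ^ p * #(degeneratePaths n τ)
      ≤ (n : ℝ)⁻¹ * (Real.sqrt n)⁻¹ ^ (2 * B + 1) * (n * ((3 * n) ^ B * B ^ p)) := by gcongr
    _ = (3 ^ B * B ^ p) * (Real.sqrt n)⁻¹ := by
        rw [pow_succ, pow_mul, inv_pow, Real.sq_sqrt (by positivity), mul_pow, inv_pow]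
        field_simp

lemma tendsto_card_degeneratePaths (τ : Fin p → Fin m) :
    Tendsto (fun n : ℕ => (n : ℝ)⁻¹ * (Real.sqrt n)⁻¹ ^ p * #(degeneratePaths n τ)) atTop
      (𝓝 0) := by
  rcases Nat.eq_zero_or_pos p with rfl | hp
  · simp [degeneratePaths]
  obtain ⟨B, hB, hBp⟩ : ∃ B, p ≤ 2 * B + 2 ∧ 2 * B + 1 ≤ p := ⟨(p - 1) / 2, by lia, by lia⟩
  have hsqrt : Tendsto (fun n : ℕ => (Real.sqrt n)⁻¹) atTop (𝓝 0) :=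
    tendsto_inv_atTop_zero.comp (Real.tendsto_sqrt_atTop.comp tendsto_natCast_atTop_atTop)
  have hlim : Tendsto (fun n : ℕ => (3 ^ B * B ^ p) * (Real.sqrt n)⁻¹) atTop (𝓝 0) := by
    simpa only [mul_zero] using hsqrt.const_mul (3 ^ B * B ^ p : ℝ)
  refine squeeze_zero' (Eventually.of_forall fun n => by positivity) ?_ hlim
  filter_upwards [eventually_ge_atTop 1, eventually_ge_atTop B] with n hn hBn
  exact card_degeneratePaths_le_sqrt τ hB hBp hn hBn

lemma tendsto_sum_closedPaths_zero (τ : Fin p → Fin m) {D : ∀ n, (Fin (p + 1) → Fin n) → ℂ} {C : ℝ}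
    (hC : ∀ n w, ‖D n w‖ ≤ C)
    (hD : ∀ n, ∀ w ∈ closedPaths (Fin n) p, w ∉ degeneratePaths n τ → D n w = 0) :
    Tendsto (fun n : ℕ => (n : ℂ)⁻¹ * (((Real.sqrt n)⁻¹ : ℝ) : ℂ) ^ p *
      ∑ w ∈ closedPaths (Fin n) p, D n w) atTop (𝓝 0) := by
  have hlim : Tendsto (fun n : ℕ => (n : ℝ)⁻¹ * (Real.sqrt n)⁻¹ ^ p * #(degeneratePaths n τ) * C)
      atTop (𝓝 0) := by
    simpa only [zero_mul] using (tendsto_card_degeneratePaths τ).mul_const C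
  refine squeeze_zero_norm (fun n => ?_) hlim
  have hsum : ∑ w ∈ closedPaths (Fin n) p, D n w = ∑ w ∈ degeneratePaths n τ, D n w :=
    (Finset.sum_subset (Finset.filter_subset _ _) fun w hw hw' => hD n w hw hw').symm
  have hbound : ‖∑ w ∈ degeneratePaths n τ, D n w‖ ≤ #(degeneratePaths n τ) * C :=
    (norm_sum_le_of_le _ fun w _ => hC n w).trans_eq (by rw [Finset.sum_const, nsmul_eq_mul])
  rw [hsum, norm_mul, norm_mul, norm_pow, norm_inv, Complex.norm_natCast, Complex.norm_real,
    norm_inv, Real.norm_of_nonneg (Real.sqrt_nonneg _), mul_assoc _ _ C]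
  gcongr

end Counting

section LatticePaths

variable {k : ℕ} (π : PairPartition k) (ε : Fin (2 * k) → StarExp)

/-- The vertices of the path with end point `q` and input indices `J` on the blocks of `π`, after
the reflection of every other vertex, which turns the Hankel step `j ↦ n - 1 - J - j` into a
translation. -/
noncomputable def latticePos (q : ℤ) (J : Fin k → ℤ) (j : ℕ) : ℤ :=
  q + ∑ ℓ : Fin (2 * k) with j ≤ ℓ.val, nu ℓ * J (π.block ℓ)

/-- The lattice version of `pathPoint`. -/
noncomputable def latticePoint (n : ℕ) (q : ℤ) (J : Fin k → ℤ) (t : Fin (2 * k)) : ℤ :=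
  if (ε t).sign * nu t = 1 then latticePos π q J (t.val + 1)
  else (n : ℤ) - 1 - latticePos π q J (t.val + 1)

/-- The lattice version of `indA`: the column `x` and the row `x + ε' J` of an entry with
`row + column ≤ n - 2`, counted from `0`. -/
noncomputable def latticeA (n : ℕ) (q : ℤ) (J : Fin k → ℤ) (t : Fin (2 * k)) : ℂ :=
  if 0 ≤ latticePoint π ε n q J t ∧ 0 ≤ latticePoint π ε n q J t + (ε t).sign * J (π.block t) ∧
    0 ≤ (n : ℤ) - 2 - (2 * latticePoint π ε n q J t + (ε t).sign * J (π.block t)) then 1 else 0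

/-- The lattice version of `indB`: the column `x` and the row `x + ε' J` of an entry with
`n - 1 ≤ row + column`, counted from `0`. -/
noncomputable def latticeB (n : ℕ) (q : ℤ) (J : Fin k → ℤ) (t : Fin (2 * k)) : ℂ :=
  if 0 ≤ (n : ℤ) - 1 - latticePoint π ε n q J t ∧
    0 ≤ (n : ℤ) - 1 - (latticePoint π ε n q J t + (ε t).sign * J (π.block t)) ∧
    0 ≤ 2 * latticePoint π ε n q J t + (ε t).sign * J (π.block t) - ((n : ℤ) - 1) then 1 else 0

/-- The covariance of the entries in positions `r` and `s`, where `αr`, `βr` indicate that the entry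
in position `r` is an `a`-entry or a `b`-entry, and likewise for `s`. -/
noncomputable def covForm (ρ : Correlations) (r s : Fin (2 * k)) (αr βr αs βs : ℂ) : ℂ :=
  entryCov ρ (ε r) true (ε s) true * (αr * αs) + entryCov ρ (ε r) false (ε s) false * (βr * βs) +
    entryCov ρ (ε r) true (ε s) false * (αr * βs) + entryCov ρ (ε r) false (ε s) true * (βr * αs)

/-- The contribution of the path with end point `q` and input indices `J`, which is `0` unless the
path is closed and stays in `{0, …, n - 1}`. -/
noncomputable def latticeWeight (ρ : Correlations) (n : ℕ) (q : ℤ) (J : Fin k → ℤ) : ℂ :=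
  if ∑ ℓ, nu ℓ * J (π.block ℓ) = 0 then
    ∏ t, covForm ε ρ (π.r t) (π.s t) (latticeA π ε n q J (π.r t)) (latticeB π ε n q J (π.r t))
      (latticeA π ε n q J (π.s t)) (latticeB π ε n q J (π.s t))
  else 0

/-- The path `w` uses the input with index `J t` in both positions of the block `t` of `π`. -/
def UsesInputs {n : ℕ} (w : Fin (2 * k + 1) → Fin n) (J : Fin k → ℤ) : Prop :=
  ∀ t : Fin (2 * k), hankelIndex (w t.castSucc) (w t.succ) = J (π.block t)

/-- Reflection of `{0, …, n - 1}` at odd times. -/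
def reflectOdd (n : ℕ) (j : ℕ) (z : ℤ) : ℤ := if Even j then z else (n : ℤ) - 1 - z

lemma sign_eq_one_or (η : StarExp) : η.sign = 1 ∨ η.sign = -1 := by
  cases η <;> simp [StarExp.sign]

lemma nu_eq_one_or (t : Fin (2 * k)) : nu t = 1 ∨ nu t = -1 := by
  unfold nu
  split_ifs <;> simp

lemma latticePos_zero (q : ℤ) (J : Fin k → ℤ) :
    latticePos π q J 0 = q + ∑ ℓ, nu ℓ * J (π.block ℓ) := by
  simp [latticePos]

lemma latticePos_last (q : ℤ) (J : Fin k → ℤ) : latticePos π q J (2 * k) = q := by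
  rw [latticePos, Finset.filter_false_of_mem fun ℓ _ => by have := ℓ.isLt; omega,
    Finset.sum_empty, add_zero]

lemma latticePos_step (q : ℤ) (J : Fin k → ℤ) (t : Fin (2 * k)) :
    latticePos π q J t.val = latticePos π q J (t.val + 1) + nu t * J (π.block t) := by
  have hinsert : ({ℓ | t.val ≤ ℓ.val} : Finset (Fin (2 * k))) =
      insert t ({ℓ | t.val + 1 ≤ ℓ.val} : Finset (Fin (2 * k))) := by
    ext ℓ
    simp only [Finset.mem_filter, Finset.mem_univ, true_and, Finset.mem_insert, Fin.ext_iff]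
    omega
  rw [latticePos, latticePos, hinsert, Finset.sum_insert (by simp)]
  ring

lemma reflectOdd_reflectOdd (n j : ℕ) (z : ℤ) : reflectOdd n j (reflectOdd n j z) = z := by
  simp only [reflectOdd]
  split_ifs <;> ring

lemma reflectOdd_of_even {j : ℕ} (hj : Even j) (n : ℕ) (z : ℤ) : reflectOdd n j z = z :=
  if_pos hj

lemma reflectOdd_mem_Ico {n : ℕ} {z : ℤ} (hz : z ∈ Set.Ico 0 (n : ℤ)) (j : ℕ) :
    reflectOdd n j z ∈ Set.Ico 0 (n : ℤ) := by
  rw [Set.mem_Ico] at hz ⊢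
  rw [reflectOdd]
  split_ifs <;> omega

lemma reflectOdd_sub_reflectOdd (n : ℕ) (t : Fin (2 * k)) (x y : ℤ) :
    reflectOdd n t.val x - reflectOdd n (t.val + 1) y = nu t * ((n : ℤ) - 1 - x - y) := by
  simp only [reflectOdd, nu, Nat.even_add_one]
  split_ifs <;> ring

variable {π}

lemma UsesInputs.latticePos_eq {n : ℕ} {w : Fin (2 * k + 1) → Fin n} {J : Fin k → ℤ}
    (hw : UsesInputs π w J) (j : Fin (2 * k + 1)) :
    latticePos π (w (Fin.last (2 * k))) J j = reflectOdd n j (w j) := by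
  induction j using Fin.reverseInduction with
  | last => rw [Fin.val_last, latticePos_last, reflectOdd_of_even (by simp)]
  | cast t ih =>
    rw [Fin.val_castSucc, latticePos_step, ← Fin.val_succ, ih, ← hw t, hankelIndex,
      ← reflectOdd_sub_reflectOdd, Fin.val_succ, add_sub_cancel]

lemma usesInputs_of_eq_reflectOdd {n : ℕ} {w : Fin (2 * k + 1) → Fin n} {q : ℤ} {J : Fin k → ℤ}
    (hw : ∀ j : Fin (2 * k + 1), (w j : ℤ) = reflectOdd n j (latticePos π q J j)) :
    UsesInputs π w J := by
  intro t
  have hstep := reflectOdd_sub_reflectOdd n t (w t.castSucc) (w t.succ)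
  rw [hw, hw, Fin.val_castSucc, Fin.val_succ, reflectOdd_reflectOdd, reflectOdd_reflectOdd,
    latticePos_step, add_sub_cancel_left] at hstep
  rw [hankelIndex, hw, hw, Fin.val_castSucc, Fin.val_succ, latticePos_step]
  have hnu : nu t ≠ 0 := by rcases nu_eq_one_or t with h | h <;> simp [h]
  exact (mul_left_cancel₀ hnu hstep).symm

lemma UsesInputs.latticePoint_eq {n : ℕ} {w : Fin (2 * k + 1) → Fin n} {J : Fin k → ℤ}
    (hw : UsesInputs π w J) (t : Fin (2 * k)) :
    latticePoint π ε n (w (Fin.last (2 * k))) J t =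
      if ε t = .one then (w t.succ : ℤ) else (n : ℤ) - 1 - w t.succ := by
  rw [latticePoint, ← Fin.val_succ, hw.latticePos_eq, reflectOdd, nu, Fin.val_succ]
  by_cases ht : Even (t.val + 1) <;> cases ε t <;> simp [ht, StarExp.sign]

lemma UsesInputs.latticeA_eq {n : ℕ} {w : Fin (2 * k + 1) → Fin n} {J : Fin k → ℤ}
    (hw : UsesInputs π w J) (t : Fin (2 * k)) :
    latticeA π ε n (w (Fin.last (2 * k))) J t =
      if isAEntry (ε t) (w t.castSucc) (w t.succ) then 1 else 0 := by
  have hrow := (w t.castSucc).isLt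
  have hcol := (w t.succ).isLt
  rw [latticeA, hw.latticePoint_eq, ← hw t, hankelIndex]
  refine if_congr ?_ rfl rfl
  cases hε : ε t <;>
    simp only [StarExp.sign, isAEntry, decide_eq_true_eq, if_true, Fin.lt_def, reduceCtorEq,
      if_false] <;> omega

lemma UsesInputs.latticeB_eq {n : ℕ} {w : Fin (2 * k + 1) → Fin n} {J : Fin k → ℤ}
    (hw : UsesInputs π w J) (t : Fin (2 * k)) :
    latticeB π ε n (w (Fin.last (2 * k))) J t =
      if isAEntry (ε t) (w t.castSucc) (w t.succ) then 0 else 1 := by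
  have hrow := (w t.castSucc).isLt
  have hcol := (w t.succ).isLt
  rw [latticeB, hw.latticePoint_eq, ← hw t, hankelIndex, ← ite_not]
  refine if_congr ?_ rfl rfl
  cases hε : ε t <;>
    simp only [StarExp.sign, isAEntry, decide_eq_true_eq, if_true, Fin.lt_def, reduceCtorEq,
      if_false] <;> omega

lemma covForm_ite (ρ : Correlations) (r s : Fin (2 * k)) (c c' : Bool) :
    covForm ε ρ r s (if c then 1 else 0) (if c then 0 else 1) (if c' then 1 else 0)
      (if c' then 0 else 1) = entryCov ρ (ε r) c (ε s) c' := by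
  cases c <;> cases c' <;> simp [covForm]

lemma UsesInputs.latticeWeight_eq {n : ℕ} {w : Fin (2 * k + 1) → Fin n} {J : Fin k → ℤ}
    (hw : UsesInputs π w J) (hclosed : w 0 = w (Fin.last (2 * k))) (ρ : Correlations) :
    latticeWeight π ε ρ n (w (Fin.last (2 * k))) J =
      ∏ t, pathCov ρ ε w (π.r t) (π.s t) := by
  have hsum : ∑ ℓ, nu ℓ * J (π.block ℓ) = 0 := by
    have hstart := hw.latticePos_eq 0
    rwa [Fin.val_zero, latticePos_zero, reflectOdd_of_even Even.zero, hclosed,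
      add_eq_left] at hstart
  rw [latticeWeight, if_pos hsum]
  refine Finset.prod_congr rfl fun t _ => ?_
  rw [hw.latticeA_eq, hw.latticeB_eq, hw.latticeA_eq, hw.latticeB_eq, covForm_ite, pathCov]

lemma latticePos_mem_Ico {ε : Fin (2 * k) → StarExp} {n : ℕ} {q : ℤ} {J : Fin k → ℤ}
    {t : Fin (2 * k)} (ht : latticeA π ε n q J t ≠ 0 ∨ latticeB π ε n q J t ≠ 0) :
    latticePos π q J t.val ∈ Set.Ico 0 (n : ℤ) := by
  have hrow : latticePoint π ε n q J t + (ε t).sign * J (π.block t) =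
      if (ε t).sign * nu t = 1 then latticePos π q J t.val
      else (n : ℤ) - 1 - latticePos π q J t.val := by
    rw [latticePoint, latticePos_step]
    rcases sign_eq_one_or (ε t) with hε | hε <;> rcases nu_eq_one_or t with hν | hν <;>
      simp only [hε, hν, Int.reduceNeg, Int.reduceMul, Int.reduceEq, if_true, if_false] <;> ring
  have hmem : 0 ≤ latticePoint π ε n q J t + (ε t).sign * J (π.block t) ∧
      latticePoint π ε n q J t + (ε t).sign * J (π.block t) < n := by
    rcases ht with ht | ht
    · have := (ite_ne_right_iff.1 ht).1
      omega
    · have := (ite_ne_right_iff.1 ht).1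
      omega
  rw [hrow] at hmem
  rw [Set.mem_Ico]
  split_ifs at hmem <;> omega

lemma ne_zero_of_covForm_ne_zero {ε : Fin (2 * k) → StarExp} {ρ : Correlations} {r s : Fin (2 * k)}
    {αr βr αs βs : ℂ} (h : covForm ε ρ r s αr βr αs βs ≠ 0) :
    (αr ≠ 0 ∨ βr ≠ 0) ∧ (αs ≠ 0 ∨ βs ≠ 0) := by
  constructor <;>
  · by_contra! hzero
    exact h (by simp [covForm, hzero.1, hzero.2])

lemma latticePos_mem_Ico_of_latticeWeight_ne_zero {ε : Fin (2 * k) → StarExp} {ρ : Correlations}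
    {n : ℕ} {q : ℤ} {J : Fin k → ℤ} (hq : q ∈ Set.Ico 0 (n : ℤ))
    (h : latticeWeight π ε ρ n q J ≠ 0) (j : Fin (2 * k + 1)) :
    latticePos π q J j ∈ Set.Ico 0 (n : ℤ) := by
  have hprod := (ite_ne_right_iff.1 h).2
  induction j using Fin.lastCases with
  | last => rwa [Fin.val_last, latticePos_last]
  | cast t =>
    have hblock := ne_zero_of_covForm_ne_zero
      (Finset.prod_ne_zero_iff.1 hprod (π.block t) (Finset.mem_univ _))
    refine latticePos_mem_Ico (ε := ε) ?_
    rcases π.block_spec t with ht | ht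
    · rw [← ht] at hblock
      exact hblock.1
    · rw [← ht] at hblock
      exact hblock.2

lemma exists_path_of_latticeWeight_ne_zero {ε : Fin (2 * k) → StarExp} {ρ : Correlations} {n : ℕ}
    {q : ℤ} {J : Fin k → ℤ} (hq : q ∈ Set.Ico 0 (n : ℤ)) (h : latticeWeight π ε ρ n q J ≠ 0) :
    ∃ w ∈ closedPaths (Fin n) (2 * k), (w (Fin.last (2 * k)) : ℤ) = q ∧ UsesInputs π w J := by
  have hmem : ∀ j : Fin (2 * k + 1), reflectOdd n j (latticePos π q J j) ∈ Set.Ico 0 (n : ℤ) :=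
    fun j => reflectOdd_mem_Ico (latticePos_mem_Ico_of_latticeWeight_ne_zero hq h j) j
  let w : Fin (2 * k + 1) → Fin n := fun j =>
    ⟨(reflectOdd n j (latticePos π q J j)).toNat,
      (Int.toNat_lt (hmem j).1).2 (hmem j).2⟩
  have hw : ∀ j, ((w j : ℕ) : ℤ) = reflectOdd n j (latticePos π q J j) := fun j =>
    Int.toNat_of_nonneg (hmem j).1
  have hlast : (w (Fin.last (2 * k)) : ℤ) = q := by
    rw [hw, Fin.val_last, latticePos_last, reflectOdd_of_even (by simp)]
  have hfirst : (w 0 : ℤ) = q := by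
    rw [hw, Fin.val_zero, latticePos_zero, (ite_ne_right_iff.1 h).1, add_zero,
      reflectOdd_of_even Even.zero]
  exact ⟨w, Finset.mem_filter.2 ⟨Finset.mem_univ _, Fin.ext (by omega)⟩, hlast,
    usesInputs_of_eq_reflectOdd hw⟩

variable (π)

lemma usesInputs_iff {n : ℕ} (w : Fin (2 * k + 1) → Fin n) :
    UsesInputs π w (fun t => hankelIndex (w (π.r t).castSucc) (w (π.r t).succ)) ↔
      ∀ t, hankelIndex (w (π.r t).castSucc) (w (π.r t).succ) =
        hankelIndex (w (π.s t).castSucc) (w (π.s t).succ) := by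
  refine ⟨fun hw t => by rw [hw (π.s t), π.block_s], fun hw t => ?_⟩
  rcases π.block_spec t with ht | ht
  · simp only [← ht]
  · simp only [hw, ← ht]

lemma sum_closedPaths_eq_sum_latticeWeight (ρ : Correlations) (n : ℕ) :
    ∑ w ∈ closedPaths (Fin n) (2 * k), ∏ t,
      (if hankelIndex (w (π.r t).castSucc) (w (π.r t).succ) =
          hankelIndex (w (π.s t).castSucc) (w (π.s t).succ) then
        pathCov ρ ε w (π.r t) (π.s t) else 0) =
      ∑ q ∈ Finset.Ico (0 : ℤ) n, ∑ J ∈ Fintype.piFinset fun _ : Fin k => Finset.Ico (-(n : ℤ)) n,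
        latticeWeight π ε ρ n q J := by
  classical
  simp_rw [Finset.prod_ite_zero, Finset.mem_univ, true_imp_iff]
  rw [← Finset.sum_filter, ← Finset.sum_product',
    Finset.filter_congr fun w _ => (usesInputs_iff π w).symm]
  refine Finset.sum_of_injOn (fun w => ((w (Fin.last (2 * k)) : ℤ),
    fun t => hankelIndex (w (π.r t).castSucc) (w (π.r t).succ))) ?_ ?_ ?_ ?_
  · intro w hw w' hw' heq
    simp only [Prod.mk.injEq] at heq
    refine path_ext (Fin.ext (by exact_mod_cast heq.1)) fun t => ?_
    rw [(Finset.mem_filter.1 hw).2, (Finset.mem_filter.1 hw').2]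
    exact congrFun heq.2 _
  · intro w _
    simp only [Finset.coe_product, Set.mem_prod, Finset.mem_coe, Finset.mem_Ico,
      Fintype.mem_piFinset, hankelIndex]
    refine ⟨by omega, fun t => ?_⟩
    have := (w (π.r t).castSucc).isLt
    have := (w (π.r t).succ).isLt
    omega
  · rintro ⟨q, J⟩ hx hnot
    by_contra h
    obtain ⟨w, hw, hq, hwJ⟩ :=
      exists_path_of_latticeWeight_ne_zero (Finset.mem_Ico.1 (Finset.mem_product.1 hx).1) h
    have hJ : (fun t => hankelIndex (w (π.r t).castSucc) (w (π.r t).succ)) = J :=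
      funext fun t => by rw [hwJ, π.block_r]
    refine hnot ⟨w, ?_, Prod.ext hq hJ⟩
    rw [Finset.mem_coe, Finset.mem_filter, hJ]
    exact ⟨hw, hwJ⟩
  · intro w hw
    obtain ⟨hclosed, hinputs⟩ := Finset.mem_filter.1 hw
    exact (hinputs.latticeWeight_eq ε (Finset.mem_filter.1 hclosed).2 ρ).symm

end LatticePaths

section RiemannSums

variable {E : Type*} [NormedAddCommGroup E] [NormedSpace ℝ E]

lemma setIntegral_comp_eq_smul_sum_of_fibers [CompleteSpace E] {α β : Type*} [MeasurableSpace α]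
    {μ : Measure α} {s : Set α} {g : α → β} {T : Finset β} (hT : ∀ z ∈ s, g z ∈ T)
    (hmeas : ∀ b ∈ T, MeasurableSet (s ∩ g ⁻¹' {b})) {c : ℝ} (hc : 0 ≤ c)
    (hvol : ∀ b ∈ T, μ (s ∩ g ⁻¹' {b}) = ENNReal.ofReal c) (f : β → E) :
    ∫ z in s, f (g z) ∂μ = c • ∑ b ∈ T, f b := by
  have hunion : s = ⋃ b ∈ T, s ∩ g ⁻¹' {b} := by
    ext z
    simp only [Set.mem_iUnion, Set.mem_inter_iff, Set.mem_preimage, Set.mem_singleton_iff,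
      exists_prop]
    exact ⟨fun hz => ⟨g z, hT z hz, hz, rfl⟩, fun ⟨_, _, hz, _⟩ => hz⟩
  have hdisj : Set.Pairwise (T : Set β) (Function.onFun Disjoint fun b => s ∩ g ⁻¹' {b}) :=
    fun b _ b' _ hbb => Set.disjoint_left.2 fun z hz hz' =>
      hbb ((show g z = b from hz.2).symm.trans hz'.2)
  have hconst : ∀ b, Set.EqOn (fun z => f (g z)) (fun _ => f b) (s ∩ g ⁻¹' {b}) :=
    fun b z hz => congrArg f hz.2
  rw [hunion, integral_biUnion_finset T hmeas hdisj fun b hb =>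
    (integrableOn_congr_fun (hconst b) (hmeas b hb)).2
      (integrableOn_const (by rw [hvol b hb]; exact ENNReal.ofReal_ne_top)), Finset.smul_sum]
  refine Finset.sum_congr rfl fun b hb => ?_
  rw [setIntegral_congr_fun (hmeas b hb) (hconst b), setIntegral_const, Measure.real, hvol b hb,
    ENNReal.toReal_ofReal hc]

lemma floor_mul_eq_iff {n : ℕ} (hn : 0 < n) (z : ℝ) (j : ℤ) :
    ⌊(n : ℝ) * z⌋ = j ↔ z ∈ Set.Ico ((j : ℝ) / n) ((j + 1) / n) := by
  have hn' : (0 : ℝ) < n := by exact_mod_cast hn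
  rw [Int.floor_eq_iff, Set.mem_Ico, div_le_iff₀ hn', lt_div_iff₀ hn', mul_comm]

lemma floor_mul_mem_Ico_iff {n : ℕ} (hn : 0 < n) (z : ℝ) (a b : ℤ) :
    ⌊(n : ℝ) * z⌋ ∈ Finset.Ico (n * a) (n * b) ↔ z ∈ Set.Ico (a : ℝ) b := by
  have hn' : (0 : ℝ) < n := by exact_mod_cast hn
  rw [Finset.mem_Ico, Set.mem_Ico, Int.le_floor, Int.floor_lt]
  push_cast
  rw [mul_le_mul_iff_right₀ hn', mul_lt_mul_iff_right₀ hn']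

lemma volume_Ico_div {n : ℕ} (j : ℤ) :
    volume (Set.Ico ((j : ℝ) / n) ((j + 1) / n)) = ENNReal.ofReal (n : ℝ)⁻¹ := by
  rw [Real.volume_Ico, ← sub_div, add_sub_cancel_left, one_div]

lemma integral_comp_floor_mul [CompleteSpace E] {n : ℕ} (hn : 0 < n) (a b : ℤ) (f : ℤ → E) :
    ∫ z in Set.Icc (a : ℝ) b, f ⌊(n : ℝ) * z⌋ =
      (n : ℝ)⁻¹ • ∑ q ∈ Finset.Ico (n * a) (n * b), f q := by
  have hcell : ∀ q ∈ Finset.Ico (n * a) (n * b),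
      Set.Ico (a : ℝ) b ∩ (fun z : ℝ => ⌊(n : ℝ) * z⌋) ⁻¹' {q} =
        Set.Ico ((q : ℝ) / n) ((q + 1) / n) := by
    intro q hq
    ext z
    rw [Set.mem_inter_iff, Set.mem_preimage, Set.mem_singleton_iff, ← floor_mul_eq_iff hn,
      ← floor_mul_mem_Ico_iff hn]
    exact and_iff_right_of_imp fun hz => hz ▸ hq
  rw [← setIntegral_congr_set Ico_ae_eq_Icc]
  refine setIntegral_comp_eq_smul_sum_of_fibers
    (fun z hz => (floor_mul_mem_Ico_iff hn z a b).2 hz) (fun q hq => ?_) (by positivity)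
    (fun q hq => ?_) f
  · rw [hcell q hq]
    exact measurableSet_Ico
  · rw [hcell q hq, volume_Ico_div]

lemma integral_comp_floor_mul_pi [CompleteSpace E] {ι : Type*} [Fintype ι] [DecidableEq ι] {n : ℕ}
    (hn : 0 < n) (a b : ℤ) (f : (ι → ℤ) → E) :
    ∫ z in Set.Icc (fun _ : ι => (a : ℝ)) (fun _ => (b : ℝ)), f (fun t => ⌊(n : ℝ) * z t⌋) =
      (n : ℝ)⁻¹ ^ Fintype.card ι •
        ∑ J ∈ Fintype.piFinset fun _ : ι => Finset.Ico (n * a) (n * b), f J := by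
  have hcell : ∀ J ∈ Fintype.piFinset fun _ : ι => Finset.Ico (n * a) (n * b),
      (Set.univ.pi fun _ : ι => Set.Ico (a : ℝ) b) ∩
        (fun (z : ι → ℝ) (t : ι) => ⌊(n : ℝ) * z t⌋) ⁻¹' {J} =
      Set.univ.pi fun t => Set.Ico ((J t : ℝ) / n) ((J t + 1) / n) := by
    intro J hJ
    rw [Fintype.mem_piFinset] at hJ
    ext z
    simp only [Set.mem_inter_iff, Set.mem_preimage, Set.mem_singleton_iff, Set.mem_univ_pi,
      ← floor_mul_eq_iff hn, ← floor_mul_mem_Ico_iff hn, funext_iff]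
    exact and_iff_right_of_imp fun hz t => hz t ▸ hJ t
  have hae := Measure.univ_pi_Ico_ae_eq_Icc (μ := fun _ : ι => (volume : Measure ℝ))
    (f := fun _ : ι => (a : ℝ)) (g := fun _ => (b : ℝ))
  rw [← volume_pi] at hae
  rw [← setIntegral_congr_set hae]
  refine setIntegral_comp_eq_smul_sum_of_fibers (fun z hz => ?_) (fun J hJ => ?_) (by positivity)
    (fun J hJ => ?_) f
  · exact Fintype.mem_piFinset.2 fun t =>
      (floor_mul_mem_Ico_iff hn (z t) a b).2 (Set.mem_univ_pi.1 hz t)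
  · rw [hcell J hJ]
    exact MeasurableSet.univ_pi fun _ => measurableSet_Ico
  · simp_rw [hcell J hJ, volume_pi_pi, volume_Ico_div]
    rw [Finset.prod_const, Finset.card_univ, ENNReal.ofReal_pow (by positivity)]

lemma tendsto_floor_mul_div (z : ℝ) :
    Tendsto (fun n : ℕ => (⌊(n : ℝ) * z⌋ : ℝ) / n) atTop (𝓝 z) := by
  have hlower : Tendsto (fun n : ℕ => z - (n : ℝ)⁻¹) atTop (𝓝 z) := by
    simpa only [sub_zero] using
      tendsto_const_nhds.sub (tendsto_inv_atTop_nhds_zero_nat (𝕜 := ℝ))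
  refine tendsto_of_tendsto_of_tendsto_of_le_of_le' hlower tendsto_const_nhds ?_ ?_
  · filter_upwards [eventually_gt_atTop 0] with n hn
    have hn' : (0 : ℝ) < n := by exact_mod_cast hn
    rw [le_div_iff₀ hn', sub_mul, inv_mul_cancel₀ hn'.ne']
    linarith [Int.lt_floor_add_one ((n : ℝ) * z)]
  · filter_upwards [eventually_gt_atTop 0] with n hn
    have hn' : (0 : ℝ) < n := by exact_mod_cast hn
    rw [div_le_iff₀ hn']
    linarith [Int.floor_le ((n : ℝ) * z)]

lemma eventually_nonneg_iff_of_tendsto_div {L : ℕ → ℤ} {l : ℝ}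
    (h : Tendsto (fun n : ℕ => (L n : ℝ) / n) atTop (𝓝 l)) (hl : l ≠ 0) :
    ∀ᶠ n in atTop, (0 ≤ L n ↔ 0 ≤ l) := by
  rcases lt_or_gt_of_ne hl with hl | hl
  · filter_upwards [h.eventually_lt_const hl] with n hn
    refine iff_of_false (fun hL => hn.not_ge ?_) (not_le.2 hl)
    exact div_nonneg (by exact_mod_cast hL) (Nat.cast_nonneg n)
  · filter_upwards [h.eventually_const_lt hl] with n hn
    refine iff_of_true (le_of_not_gt fun hL => hn.not_ge ?_) hl.le
    exact div_nonpos_of_nonpos_of_nonneg (by exact_mod_cast hL.le) (Nat.cast_nonneg n)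

lemma tendsto_integral_integral_of_bounded {α β : Type*} [MeasurableSpace α] [MeasurableSpace β]
    {μ : Measure α} {ν : Measure β} [IsFiniteMeasure μ] [IsFiniteMeasure ν] {F : ℕ → α × β → E}
    {g : α × β → E} {C : ℝ} (hF : ∀ n, AEStronglyMeasurable (F n) (μ.prod ν))
    (hC : ∀ n x, ‖F n x‖ ≤ C)
    (hlim : ∀ᵐ x ∂μ.prod ν, Tendsto (fun n => F n x) atTop (𝓝 (g x))) :
    Tendsto (fun n => ∫ x, ∫ y, F n (x, y) ∂ν ∂μ) atTop (𝓝 (∫ x, ∫ y, g (x, y) ∂ν ∂μ)) := by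
  have hFint : ∀ n, Integrable (F n) (μ.prod ν) := fun n =>
    Integrable.of_bound (hF n) C (ae_of_all _ (hC n))
  have hgint : Integrable g (μ.prod ν) := by
    refine Integrable.of_bound (aestronglyMeasurable_of_tendsto_ae atTop hF hlim) C ?_
    filter_upwards [hlim] with x hx
    exact le_of_tendsto' hx.norm fun n => hC n x
  simp_rw [← integral_prod _ hgint, ← integral_prod _ (hFint _)]
  exact tendsto_integral_of_dominated_convergence (fun _ => C) hF (integrable_const C)
    (fun n => ae_of_all _ (hC n)) hlim

end RiemannSums

section LatticeLimit

variable {k : ℕ} (π : PairPartition k) (ε : Fin (2 * k) → StarExp)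

lemma PairPartition.sum_eq_sum_pairs {M : Type*} [AddCommMonoid M] (f : Fin (2 * k) → M) :
    ∑ ℓ, f ℓ = ∑ t, (f (π.r t) + f (π.s t)) := by
  rw [← Finset.sum_fiberwise (s := Finset.univ) (g := π.block)]
  refine Finset.sum_congr rfl fun t _ => ?_
  have hfiber : ({ℓ | π.block ℓ = t} : Finset (Fin (2 * k))) = {π.r t, π.s t} := by
    ext ℓ
    simp only [Finset.mem_filter, Finset.mem_univ, true_and, Finset.mem_insert,
      Finset.mem_singleton]
    exact ⟨fun h => h ▸ π.block_spec ℓ, π.block_eq⟩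
  rw [hfiber, Finset.sum_pair (π.r_ne_s t)]

lemma ae_linearMap_add_ne_zero {E : Type*} [NormedAddCommGroup E] [NormedSpace ℝ E]
    [FiniteDimensional ℝ E] [MeasurableSpace E] [BorelSpace E] (μ : Measure E)
    [μ.IsAddHaarMeasure] {L : E →ₗ[ℝ] ℝ} (hL : L ≠ 0) (d : ℝ) : ∀ᵐ x ∂μ, L x + d ≠ 0 := by
  have hne : ∀ᵐ y : ℝ, y ∈ ({-d}ᶜ : Set ℝ) := by simp [ae_iff]
  filter_upwards [(ae_comp_linearMap_mem_iff L μ volume (LinearMap.surjective hL)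
    (measurableSet_singleton (-d)).compl).2 hne] with x hx hzero
  exact hx (eq_neg_of_add_eq_zero_left hzero)

/-- `tailSum` as a linear functional of `(z₀, z)`. -/
noncomputable def tailLinear (t : Fin (2 * k)) : ℝ × (Fin k → ℝ) →ₗ[ℝ] ℝ :=
  LinearMap.fst ℝ ℝ (Fin k → ℝ) + ∑ ℓ ∈ Finset.Ioi t,
    (nu ℓ : ℝ) • (LinearMap.proj (π.block ℓ) ∘ₗ LinearMap.snd ℝ ℝ (Fin k → ℝ))

lemma tailLinear_apply (t : Fin (2 * k)) (x : ℝ × (Fin k → ℝ)) :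
    tailLinear π t x = tailSum π x.1 x.2 t := by
  simp [tailLinear, tailSum, LinearMap.sum_apply]

lemma ae_pathPoint_affine_ne_zero (t : Fin (2 * k)) {a : ℝ} (ha : a ≠ 0) (b d : ℝ) :
    ∀ᵐ x : ℝ × (Fin k → ℝ), a * pathPoint π ε x.1 x.2 t + b * x.2 (π.block t) + d ≠ 0 := by
  have haffine : ∀ c : ℝ, c ≠ 0 → ∀ e : ℝ, ∀ᵐ x : ℝ × (Fin k → ℝ),
      c * tailSum π x.1 x.2 t + b * x.2 (π.block t) + e ≠ 0 := by
    intro c hc e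
    let L : ℝ × (Fin k → ℝ) →ₗ[ℝ] ℝ := c • tailLinear π t +
      b • (LinearMap.proj (π.block t) ∘ₗ LinearMap.snd ℝ ℝ (Fin k → ℝ))
    have hL : ∀ x, L x = c * tailSum π x.1 x.2 t + b * x.2 (π.block t) := fun x => by
      simp [L, tailLinear_apply]
    have hL0 : L ≠ 0 := by
      intro hzero
      have hone := hL (1, 0)
      rw [hzero] at hone
      exact hc (by simpa [tailSum] using hone.symm)
    simp_rw [← hL]
    exact ae_linearMap_add_ne_zero ((volume : Measure ℝ).prod volume) hL0 e
  unfold pathPoint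
  split_ifs
  · exact haffine a ha d
  · filter_upwards [haffine (-a) (neg_ne_zero.2 ha) (a + d)] with x hx hzero
    exact hx (by linarith)

lemma ae_closing_ne_zero {t₀ : Fin k} (ht₀ : nu (π.r t₀) = nu (π.s t₀)) :
    ∀ᵐ x : ℝ × (Fin k → ℝ), ∑ ℓ, (nu ℓ : ℝ) * x.2 (π.block ℓ) ≠ 0 := by
  let L : ℝ × (Fin k → ℝ) →ₗ[ℝ] ℝ := ∑ ℓ, (nu ℓ : ℝ) •
    (LinearMap.proj (π.block ℓ) ∘ₗ LinearMap.snd ℝ ℝ (Fin k → ℝ))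
  have hL : ∀ x, L x = ∑ ℓ, (nu ℓ : ℝ) * x.2 (π.block ℓ) := fun x => by
    simp [L, LinearMap.sum_apply]
  have hL0 : L (0, Pi.single t₀ 1) = 2 * nu (π.r t₀) := by
    rw [hL, π.sum_eq_sum_pairs, Finset.sum_eq_single t₀]
    · simp only [π.block_r, π.block_s, Pi.single_eq_same, mul_one, ← ht₀]
      ring
    · intro t _ ht
      simp only [π.block_r, π.block_s, Pi.single_eq_of_ne ht, mul_zero, add_zero]
    · exact fun h => absurd (Finset.mem_univ t₀) h
  have hne : L ≠ 0 := by
    intro hzero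
    rw [hzero, LinearMap.zero_apply] at hL0
    rcases nu_eq_one_or (π.r t₀) with hν | hν <;> norm_num [hν] at hL0
  simp_rw [← hL]
  filter_upwards [ae_linearMap_add_ne_zero ((volume : Measure ℝ).prod volume) hne 0] with x hx
  rwa [add_zero] at hx

lemma tendsto_latticePos (z₀ : ℝ) (z : Fin k → ℝ) (t : Fin (2 * k)) :
    Tendsto (fun n : ℕ =>
      (latticePos π ⌊(n : ℝ) * z₀⌋ (fun i => ⌊(n : ℝ) * z i⌋) (t.val + 1) : ℝ) / n)
      atTop (𝓝 (tailSum π z₀ z t)) := by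
  have hIoi : ({ℓ | t.val + 1 ≤ ℓ.val} : Finset (Fin (2 * k))) = Finset.Ioi t := by
    ext ℓ
    simp only [Finset.mem_filter, Finset.mem_univ, true_and, Finset.mem_Ioi, Fin.lt_def,
      Nat.succ_le_iff]
  have hlim := (tendsto_floor_mul_div z₀).add (tendsto_finsetSum (Finset.Ioi t)
    fun ℓ _ => (tendsto_floor_mul_div (z (π.block ℓ))).const_mul (nu ℓ : ℝ))
  refine hlim.congr fun n => ?_
  rw [latticePos, hIoi]
  push_cast
  rw [add_div, Finset.sum_div]
  simp_rw [mul_div_assoc]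

lemma tendsto_latticePoint (z₀ : ℝ) (z : Fin k → ℝ) (t : Fin (2 * k)) :
    Tendsto (fun n : ℕ =>
      (latticePoint π ε n ⌊(n : ℝ) * z₀⌋ (fun i => ⌊(n : ℝ) * z i⌋) t : ℝ) / n)
      atTop (𝓝 (pathPoint π ε z₀ z t)) := by
  unfold latticePoint pathPoint
  split_ifs
  · exact tendsto_latticePos π z₀ z t
  · have hone : Tendsto (fun n : ℕ => 1 - (n : ℝ)⁻¹) atTop (𝓝 1) := by
      simpa only [sub_zero] using
        tendsto_const_nhds.sub (tendsto_inv_atTop_nhds_zero_nat (𝕜 := ℝ))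
    refine (hone.sub (tendsto_latticePos π z₀ z t)).congr' ?_
    filter_upwards [eventually_gt_atTop 0] with n hn
    have hn' : (n : ℝ) ≠ 0 := by positivity
    push_cast
    field_simp

lemma ae_eventually_affine_nonneg_iff (t : Fin (2 * k)) {a : ℤ} (ha : a ≠ 0) (b c d : ℤ) :
    ∀ᵐ x : ℝ × (Fin k → ℝ), ∀ᶠ n : ℕ in atTop,
      (0 ≤ a * latticePoint π ε n ⌊(n : ℝ) * x.1⌋ (fun i => ⌊(n : ℝ) * x.2 i⌋) t +
        b * ⌊(n : ℝ) * x.2 (π.block t)⌋ + c * n + d ↔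
      0 ≤ (a : ℝ) * pathPoint π ε x.1 x.2 t + b * x.2 (π.block t) + c) := by
  filter_upwards [ae_pathPoint_affine_ne_zero π ε t (Int.cast_ne_zero.2 ha) b c] with x hx
  refine eventually_nonneg_iff_of_tendsto_div ?_ hx
  have hlim := ((((tendsto_latticePoint π ε x.1 x.2 t).const_mul (a : ℝ)).add
    ((tendsto_floor_mul_div (x.2 (π.block t))).const_mul (b : ℝ))).add_const (c : ℝ)).add
    ((tendsto_inv_atTop_nhds_zero_nat (𝕜 := ℝ)).const_mul (d : ℝ))
  rw [mul_zero, add_zero] at hlim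
  refine hlim.congr' ?_
  filter_upwards [eventually_gt_atTop 0] with n hn
  have hn' : (n : ℝ) ≠ 0 := by positivity
  push_cast
  field_simp

lemma ae_eventually_latticeA_eq_indA (t : Fin (2 * k)) :
    ∀ᵐ x : ℝ × (Fin k → ℝ), ∀ᶠ n : ℕ in atTop,
      latticeA π ε n ⌊(n : ℝ) * x.1⌋ (fun i => ⌊(n : ℝ) * x.2 i⌋) t = indA π ε x.1 x.2 t := by
  filter_upwards [ae_eventually_affine_nonneg_iff π ε t (a := 1) (by norm_num) 0 0 0,
    ae_eventually_affine_nonneg_iff π ε t (a := 1) (by norm_num) (ε t).sign 0 0,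
    ae_eventually_affine_nonneg_iff π ε t (a := -2) (by norm_num) (-(ε t).sign) 1 (-2)]
    with x hcol hrow hdiag
  filter_upwards [hcol, hrow, hdiag] with n hcol hrow hdiag
  push_cast at hcol hrow hdiag
  classical
  rw [latticeA, indA, Set.indicator_apply]
  refine if_congr ?_ rfl rfl
  rw [limA, Set.mem_Icc, max_le_iff, and_assoc]
  refine and_congr ?_ (and_congr ?_ ?_)
  · exact ⟨fun h => by linarith [hcol.1 (by linarith)], fun h => by linarith [hcol.2 (by linarith)]⟩
  · exact ⟨fun h => by linarith [hrow.1 (by linarith)], fun h => by linarith [hrow.2 (by linarith)]⟩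
  · exact ⟨fun h => by linarith [hdiag.1 (by linarith)],
      fun h => by linarith [hdiag.2 (by linarith)]⟩

lemma ae_eventually_latticeB_eq_indB (t : Fin (2 * k)) :
    ∀ᵐ x : ℝ × (Fin k → ℝ), ∀ᶠ n : ℕ in atTop,
      latticeB π ε n ⌊(n : ℝ) * x.1⌋ (fun i => ⌊(n : ℝ) * x.2 i⌋) t = indB π ε x.1 x.2 t := by
  filter_upwards [ae_eventually_affine_nonneg_iff π ε t (a := -1) (by norm_num) 0 1 (-1),
    ae_eventually_affine_nonneg_iff π ε t (a := -1) (by norm_num) (-(ε t).sign) 1 (-1),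
    ae_eventually_affine_nonneg_iff π ε t (a := 2) (by norm_num) (ε t).sign (-1) 1]
    with x hcol hrow hdiag
  filter_upwards [hcol, hrow, hdiag] with n hcol hrow hdiag
  push_cast at hcol hrow hdiag
  classical
  rw [latticeB, indB, Set.indicator_apply]
  refine if_congr ?_ rfl rfl
  rw [limB, Set.mem_Icc, le_min_iff, and_rotate, and_left_comm]
  refine and_congr ?_ (and_congr ?_ ?_)
  · exact ⟨fun h => by linarith [hdiag.1 (by linarith)],
      fun h => by linarith [hdiag.2 (by linarith)]⟩
  · exact ⟨fun h => by linarith [hrow.1 (by linarith)], fun h => by linarith [hrow.2 (by linarith)]⟩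
  · exact ⟨fun h => by linarith [hcol.1 (by linarith)], fun h => by linarith [hcol.2 (by linarith)]⟩

lemma hankelE_eq_covForm (ρ : Correlations) (r s : Fin (2 * k)) (z₀ : ℝ) (z : Fin k → ℝ) :
    hankelE ρ π ε r s z₀ z =
      covForm ε ρ r s (indA π ε z₀ z r) (indB π ε z₀ z r) (indA π ε z₀ z s) (indB π ε z₀ z s) *
        (1 - (kron (nu r) (nu s) : ℂ)) := rfl

lemma eventually_closing_ne_zero {z : Fin k → ℝ} (hz : ∑ ℓ, (nu ℓ : ℝ) * z (π.block ℓ) ≠ 0) :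
    ∀ᶠ n : ℕ in atTop, ∑ ℓ, nu ℓ * ⌊(n : ℝ) * z (π.block ℓ)⌋ ≠ 0 := by
  have hlim : Tendsto (fun n : ℕ => ∑ ℓ, (nu ℓ : ℝ) * ((⌊(n : ℝ) * z (π.block ℓ)⌋ : ℝ) / n)) atTop
      (𝓝 (∑ ℓ, (nu ℓ : ℝ) * z (π.block ℓ))) :=
    tendsto_finsetSum _ fun ℓ _ => (tendsto_floor_mul_div (z (π.block ℓ))).const_mul (nu ℓ : ℝ)
  filter_upwards [hlim.eventually_ne hz] with n hn hzero
  have hzero' : ∑ ℓ, (nu ℓ : ℝ) * (⌊(n : ℝ) * z (π.block ℓ)⌋ : ℝ) = 0 := by exact_mod_cast hzero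
  simp_rw [← mul_div_assoc, ← Finset.sum_div, hzero', zero_div, ne_eq, not_true] at hn

variable {π} in
lemma ae_tendsto_latticeWeight_of_nu_eq {t₀ : Fin k} (ht₀ : nu (π.r t₀) = nu (π.s t₀))
    (ρ : Correlations) :
    ∀ᵐ x : ℝ × (Fin k → ℝ), Tendsto
      (fun n : ℕ => latticeWeight π ε ρ n ⌊(n : ℝ) * x.1⌋ (fun t => ⌊(n : ℝ) * x.2 t⌋)) atTop
      (𝓝 (∏ t, hankelE ρ π ε (π.r t) (π.s t) x.1 x.2)) := by
  filter_upwards [ae_closing_ne_zero π ht₀] with x hx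
  rw [Finset.prod_eq_zero (Finset.mem_univ t₀)
    (by rw [hankelE_eq_covForm, kron, if_pos ht₀, Nat.cast_one, sub_self, mul_zero])]
  refine tendsto_const_nhds.congr' ?_
  filter_upwards [eventually_closing_ne_zero π hx] with n hn
  rw [latticeWeight, if_neg hn]

variable {π} in
lemma closing_eq_zero_of_nu_ne (hν : ∀ t, nu (π.r t) ≠ nu (π.s t)) (J : Fin k → ℤ) :
    ∑ ℓ, nu ℓ * J (π.block ℓ) = 0 := by
  rw [π.sum_eq_sum_pairs]
  refine Finset.sum_eq_zero fun t _ => ?_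
  rw [π.block_r, π.block_s, ← add_mul]
  have hne := hν t
  have hsum : nu (π.r t) + nu (π.s t) = 0 := by
    rcases nu_eq_one_or (π.r t) with hr | hr <;> rcases nu_eq_one_or (π.s t) with hs | hs <;> omega
  rw [hsum, zero_mul]

variable {π} in
lemma ae_tendsto_latticeWeight_of_nu_ne (hν : ∀ t, nu (π.r t) ≠ nu (π.s t)) (ρ : Correlations) :
    ∀ᵐ x : ℝ × (Fin k → ℝ), Tendsto
      (fun n : ℕ => latticeWeight π ε ρ n ⌊(n : ℝ) * x.1⌋ (fun t => ⌊(n : ℝ) * x.2 t⌋)) atTop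
      (𝓝 (∏ t, hankelE ρ π ε (π.r t) (π.s t) x.1 x.2)) := by
  filter_upwards [ae_all_iff.2 (ae_eventually_latticeA_eq_indA π ε),
    ae_all_iff.2 (ae_eventually_latticeB_eq_indB π ε)] with x hA hB
  refine tendsto_const_nhds.congr' ?_
  filter_upwards [eventually_all.2 hA, eventually_all.2 hB] with n hA hB
  rw [latticeWeight, if_pos (closing_eq_zero_of_nu_ne hν fun t => ⌊(n : ℝ) * x.2 t⌋)]
  refine Finset.prod_congr rfl fun t _ => ?_
  rw [hankelE_eq_covForm, kron, if_neg (hν t), hA, hB, hA, hB, Nat.cast_zero, sub_zero, mul_one]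

lemma ae_tendsto_latticeWeight (ρ : Correlations) :
    ∀ᵐ x : ℝ × (Fin k → ℝ), Tendsto
      (fun n : ℕ => latticeWeight π ε ρ n ⌊(n : ℝ) * x.1⌋ (fun t => ⌊(n : ℝ) * x.2 t⌋)) atTop
      (𝓝 (∏ t, hankelE ρ π ε (π.r t) (π.s t) x.1 x.2)) := by
  by_cases hν : ∃ t, nu (π.r t) = nu (π.s t)
  · exact ae_tendsto_latticeWeight_of_nu_eq ε hν.choose_spec ρ
  · exact ae_tendsto_latticeWeight_of_nu_ne ε (not_exists.1 hν) ρ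

lemma exists_norm_entryCov_le (ρ : Correlations) :
    ∃ C : ℝ, 0 ≤ C ∧ ∀ η c η' c', ‖entryCov ρ η c η' c'‖ ≤ C := by
  have : Finite StarExp := Finite.of_injective (fun η : StarExp => decide (η = .one)) (by
    intro a b
    cases a <;> cases b <;> simp)
  obtain ⟨C, hC⟩ := (Set.finite_range fun x : StarExp × Bool × StarExp × Bool =>
    ‖entryCov ρ x.1 x.2.1 x.2.2.1 x.2.2.2‖).bddAbove
  have h : ∀ η c η' c', ‖entryCov ρ η c η' c'‖ ≤ C := fun η c η' c' => hC ⟨(η, c, η', c'), rfl⟩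
  exact ⟨C, (norm_nonneg _).trans (h .one true .one true), h⟩

lemma norm_latticeA_le_one (n : ℕ) (q : ℤ) (J : Fin k → ℤ) (t : Fin (2 * k)) :
    ‖latticeA π ε n q J t‖ ≤ 1 := by
  rw [latticeA]
  split_ifs <;> simp

lemma norm_latticeB_le_one (n : ℕ) (q : ℤ) (J : Fin k → ℤ) (t : Fin (2 * k)) :
    ‖latticeB π ε n q J t‖ ≤ 1 := by
  rw [latticeB]
  split_ifs <;> simp

lemma norm_covForm_le {ρ : Correlations} {C : ℝ} (hC : ∀ η c η' c', ‖entryCov ρ η c η' c'‖ ≤ C)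
    (r s : Fin (2 * k)) {αr βr αs βs : ℂ} (hαr : ‖αr‖ ≤ 1) (hβr : ‖βr‖ ≤ 1) (hαs : ‖αs‖ ≤ 1)
    (hβs : ‖βs‖ ≤ 1) : ‖covForm ε ρ r s αr βr αs βs‖ ≤ 4 * C := by
  have hterm : ∀ {c x y : ℂ}, ‖c‖ ≤ C → ‖x‖ ≤ 1 → ‖y‖ ≤ 1 → ‖c * (x * y)‖ ≤ C := by
    intro c x y hc hx hy
    rw [norm_mul, norm_mul]
    exact (mul_le_of_le_one_right (norm_nonneg c)
      (mul_le_one₀ hx (norm_nonneg y) hy)).trans hc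
  refine norm_add₄_le.trans ?_
  linarith [hterm (hC (ε r) true (ε s) true) hαr hαs, hterm (hC (ε r) false (ε s) false) hβr hβs,
    hterm (hC (ε r) true (ε s) false) hαr hβs, hterm (hC (ε r) false (ε s) true) hβr hαs]

lemma norm_latticeWeight_le {ρ : Correlations} {C : ℝ} (hC₀ : 0 ≤ C)
    (hC : ∀ η c η' c', ‖entryCov ρ η c η' c'‖ ≤ C) (n : ℕ) (q : ℤ) (J : Fin k → ℤ) :
    ‖latticeWeight π ε ρ n q J‖ ≤ (4 * C) ^ k := by
  rw [latticeWeight]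
  split_ifs
  · rw [norm_prod]
    refine (Finset.prod_le_prod (fun _ _ => norm_nonneg _) fun t _ => ?_).trans_eq
      (by rw [Finset.prod_const, Finset.card_univ, Fintype.card_fin])
    exact norm_covForm_le ε hC _ _ (norm_latticeA_le_one ..) (norm_latticeB_le_one ..)
      (norm_latticeA_le_one ..) (norm_latticeB_le_one ..)
  · rw [norm_zero]
    positivity

lemma sum_latticeWeight_eq_integral (ρ : Correlations) {n : ℕ} (hn : 0 < n) :
    (n : ℂ)⁻¹ * ((n : ℂ)⁻¹ ^ k * ∑ q ∈ Finset.Ico (0 : ℤ) n,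
      ∑ J ∈ Fintype.piFinset fun _ : Fin k => Finset.Ico (-(n : ℤ)) n,
        latticeWeight π ε ρ n q J) =
      ∫ z₀ in Set.Icc (0 : ℝ) 1, ∫ z in Set.Icc (fun _ : Fin k => (-1 : ℝ)) (fun _ => 1),
        latticeWeight π ε ρ n ⌊(n : ℝ) * z₀⌋ (fun t => ⌊(n : ℝ) * z t⌋) := by
  have houter := integral_comp_floor_mul hn 0 1 fun q => (n : ℂ)⁻¹ ^ k *
    ∑ J ∈ Fintype.piFinset fun _ : Fin k => Finset.Ico (-(n : ℤ)) n, latticeWeight π ε ρ n q J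
  have hinner : ∀ q, ∫ z in Set.Icc (fun _ : Fin k => (-1 : ℝ)) (fun _ => 1),
      latticeWeight π ε ρ n q (fun t => ⌊(n : ℝ) * z t⌋) = (n : ℂ)⁻¹ ^ k *
        ∑ J ∈ Fintype.piFinset fun _ : Fin k => Finset.Ico (-(n : ℤ)) n,
          latticeWeight π ε ρ n q J := by
    intro q
    have h := integral_comp_floor_mul_pi hn (-1) 1 (latticeWeight π ε ρ n q)
    simpa using h
  simp_rw [hinner]
  simpa [Finset.mul_sum] using houter.symm

lemma measurable_latticeWeight_floor (ρ : Correlations) (n : ℕ) :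
    Measurable fun x : ℝ × (Fin k → ℝ) =>
      latticeWeight π ε ρ n ⌊(n : ℝ) * x.1⌋ (fun t => ⌊(n : ℝ) * x.2 t⌋) :=
  (Measurable.of_discrete (f := fun y : ℤ × (Fin k → ℤ) => latticeWeight π ε ρ n y.1 y.2)).comp
    (by fun_prop : Measurable fun x : ℝ × (Fin k → ℝ) =>
      (⌊(n : ℝ) * x.1⌋, fun t => ⌊(n : ℝ) * x.2 t⌋))

lemma tendsto_sum_latticeWeight (ρ : Correlations) :
    Tendsto (fun n : ℕ => (n : ℂ)⁻¹ * ((n : ℂ)⁻¹ ^ k * ∑ q ∈ Finset.Ico (0 : ℤ) n,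
        ∑ J ∈ Fintype.piFinset fun _ : Fin k => Finset.Ico (-(n : ℤ)) n,
          latticeWeight π ε ρ n q J)) atTop
      (𝓝 (∫ z₀ in Set.Icc (0 : ℝ) 1, ∫ z in Set.Icc (fun _ : Fin k => (-1 : ℝ)) (fun _ => 1),
        ∏ t : Fin k, hankelE ρ π ε (π.r t) (π.s t) z₀ z)) := by
  obtain ⟨C, hC₀, hC⟩ := exists_norm_entryCov_le ρ
  have hfinite : IsFiniteMeasure
      (volume.restrict (Set.Icc (fun _ : Fin k => (-1 : ℝ)) (fun _ => 1))) :=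
    isFiniteMeasure_restrict.2 isCompact_Icc.measure_ne_top
  have hlim := tendsto_integral_integral_of_bounded
    (μ := volume.restrict (Set.Icc (0 : ℝ) 1))
    (ν := volume.restrict (Set.Icc (fun _ : Fin k => (-1 : ℝ)) (fun _ => 1)))
    (F := fun n x => latticeWeight π ε ρ n ⌊(n : ℝ) * x.1⌋ fun t => ⌊(n : ℝ) * x.2 t⌋)
    (g := fun x => ∏ t, hankelE ρ π ε (π.r t) (π.s t) x.1 x.2)
    (fun n => (measurable_latticeWeight_floor π ε ρ n).aestronglyMeasurable)
    (fun n x => norm_latticeWeight_le π ε hC₀ hC n _ _)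
    (by rw [Measure.prod_restrict]
        exact ae_restrict_of_ae (ae_tendsto_latticeWeight π ε ρ))
  refine hlim.congr' ?_
  filter_upwards [eventually_gt_atTop 0] with n hn
  exact (sum_latticeWeight_eq_integral π ε ρ hn).symm

end LatticeLimit

section StarPolynomials

/-- The other exponent. -/
def StarExp.flip : StarExp → StarExp
  | .one => .star
  | .star => .one

/-- The noncommutative `*`-polynomials in indeterminates indexed by `ι`: the monoid algebra of the
words in the letters `x_i` and `x_i^*`. -/
abbrev StarPoly (ι : Type*) : Type _ := MonoidAlgebra ℂ (FreeMonoid (ι × StarExp))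

namespace StarPoly

variable {ι : Type*}

/-- The adjoint of a word: the word is reversed and all its exponents are flipped. It is encoded as
a homomorphism into the opposite monoid. Mathlib's `star` on `FreeMonoid` only reverses. -/
def wordStar : FreeMonoid (ι × StarExp) →* (FreeMonoid (ι × StarExp))ᵐᵒᵖ :=
  FreeMonoid.lift fun x => MulOpposite.op (FreeMonoid.of (x.1, x.2.flip))

lemma wordStar_wordStar (w : FreeMonoid (ι × StarExp)) :
    (wordStar (wordStar w).unop).unop = w := by
  induction w using FreeMonoid.inductionOn' with
  | one => simp
  | of_mul x w ih =>
    rw [map_mul, MulOpposite.unop_mul, map_mul, MulOpposite.unop_mul, ih]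
    congr 1
    obtain ⟨i, e⟩ := x
    cases e <;> rfl

/-- The adjoint of a `*`-polynomial, encoded as a ring homomorphism into the opposite ring. -/
noncomputable def starHom : StarPoly ι →+* (StarPoly ι)ᵐᵒᵖ :=
  MonoidAlgebra.liftNCRingHom ((algebraMap ℂ (StarPoly ι)ᵐᵒᵖ).comp (starRingEnd ℂ))
    ((MonoidHom.op (MonoidAlgebra.of ℂ (FreeMonoid (ι × StarExp)))).comp wordStar)
    fun c _ => Algebra.commute_algebraMap_left (starRingEnd ℂ c) _

lemma unop_starHom_single (w : FreeMonoid (ι × StarExp)) (c : ℂ) :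
    (starHom (MonoidAlgebra.single w c)).unop =
      MonoidAlgebra.single (wordStar w).unop (star c) := by
  rw [starHom, MonoidAlgebra.liftNCRingHom_single]
  simp

noncomputable instance : StarRing (StarPoly ι) where
  star a := (starHom a).unop
  star_involutive a := by
    induction a using MonoidAlgebra.induction_linear with
    | zero => simp
    | add a b ha hb => simp only [map_add, MulOpposite.unop_add, ha, hb]
    | single w c =>
      simp only [unop_starHom_single, wordStar_wordStar, star_star]
  star_mul a b := by rw [map_mul, MulOpposite.unop_mul]
  star_add a b := by rw [map_add, MulOpposite.unop_add]

lemma star_single (w : FreeMonoid (ι × StarExp)) (c : ℂ) :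
    star (MonoidAlgebra.single w c : StarPoly ι) =
      MonoidAlgebra.single (wordStar w).unop (star c) :=
  unop_starHom_single w c

instance : StarModule ℂ (StarPoly ι) where
  star_smul c a := by
    induction a using MonoidAlgebra.induction_linear with
    | zero => simp
    | add a b ha hb => simp only [smul_add, star_add, ha, hb]
    | single w d => simp [star_single]

/-- The indeterminate `x_i`. -/
noncomputable def X (i : ι) : StarPoly ι :=
  MonoidAlgebra.of ℂ _ (FreeMonoid.of (i, .one))

variable {B : Type*} [Ring B] [StarRing B]

/-- The value of a word at elements of a `*`-ring. -/
def wordEval (M : ι → B) : FreeMonoid (ι × StarExp) →* B :=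
  FreeMonoid.lift fun x => x.2.app (M x.1)

lemma wordEval_eq_starWord {m : ℕ} (M : Fin m → B) (w : FreeMonoid (Fin m × StarExp)) :
    wordEval M w = starWord M (fun t => (w.toList.get t).1) (fun t => (w.toList.get t).2) := by
  rw [wordEval, FreeMonoid.lift_apply, starWord]
  congr 1
  exact List.ext_get (by simp) (by simp)

lemma wordEval_wordStar (M : ι → B) (w : FreeMonoid (ι × StarExp)) :
    wordEval M (wordStar w).unop = star (wordEval M w) := by
  induction w using FreeMonoid.inductionOn' with
  | one => simp
  | of_mul x w ih =>
    rw [map_mul, MulOpposite.unop_mul, map_mul, map_mul, star_mul, ih]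
    congr 1
    obtain ⟨i, e⟩ := x
    cases e <;> simp [wordStar, wordEval, StarExp.flip, StarExp.app]

variable [Algebra ℂ B]

/-- The value of a `*`-polynomial at elements of a complex `*`-algebra. -/
noncomputable def eval (M : ι → B) : StarPoly ι →ₐ[ℂ] B :=
  MonoidAlgebra.lift ℂ B (FreeMonoid (ι × StarExp)) (wordEval M)

lemma eval_single (M : ι → B) (w : FreeMonoid (ι × StarExp)) (c : ℂ) :
    eval M (MonoidAlgebra.single w c) = c • wordEval M w :=
  MonoidAlgebra.lift_single _ _ _

lemma eval_X (M : ι → B) (i : ι) : eval M (X i) = M i := by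
  simp [X, eval, wordEval, StarExp.app]

lemma eval_star [StarModule ℂ B] (M : ι → B) (a : StarPoly ι) :
    eval M (star a) = star (eval M a) := by
  induction a using MonoidAlgebra.induction_linear with
  | zero => simp
  | add a b ha hb => simp only [star_add, map_add, ha, hb]
  | single w c => rw [star_single, eval_single, eval_single, wordEval_wordStar, star_smul]

lemma eval_starWord [StarModule ℂ B] {m p : ℕ} (M : Fin m → B) (τ : Fin p → Fin m)
    (ε : Fin p → StarExp) : eval M (starWord X τ ε) = starWord M τ ε := by
  rw [starWord, map_list_prod, List.map_ofFn, starWord]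
  congr 2
  funext t
  cases h : ε t <;> simp [StarExp.app, h, eval_star, eval_X]

/-- The linear functional on `*`-polynomials with prescribed values on the words. -/
noncomputable def ofMoments (μ : FreeMonoid (ι × StarExp) → ℂ) : StarPoly ι →ₗ[ℂ] ℂ :=
  Finsupp.linearCombination ℂ μ ∘ₗ (MonoidAlgebra.coeffLinearEquiv ℂ).toLinearMap

lemma ofMoments_single (μ : FreeMonoid (ι × StarExp) → ℂ) (w : FreeMonoid (ι × StarExp)) (c : ℂ) :
    ofMoments μ (MonoidAlgebra.single w c) = c * μ w := by
  simp [ofMoments]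

end StarPoly

end StarPolynomials

section LimitState

lemma trace_mul_star_self {n : Type*} [Fintype n] (A : Matrix n n ℂ) :
    (A * star A).trace = ((∑ i, ∑ j, ‖A i j‖ ^ 2 : ℝ) : ℂ) := by
  simp [Matrix.trace, Matrix.mul_apply, Complex.mul_conj, Complex.normSq_eq_norm_sq]

section ExpTrace

variable {Ω : Type*} [MeasurableSpace Ω] {P : Measure Ω} {n : ℕ}

lemma expTrace_mul_star_self (A : Ω → Matrix (Fin n) (Fin n) ℂ) :
    expTrace P (fun ω => A ω * star (A ω)) =
      (((n : ℝ)⁻¹ * ∫ ω, ∑ i, ∑ j, ‖A ω i j‖ ^ 2 ∂P : ℝ) : ℂ) := by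
  simp_rw [expTrace, trace_mul_star_self]
  rw [integral_complex_ofReal]
  push_cast
  rfl

lemma expTrace_one [IsProbabilityMeasure P] (hn : n ≠ 0) :
    expTrace P (fun _ => (1 : Matrix (Fin n) (Fin n) ℂ)) = 1 := by
  simp [expTrace, hn]

lemma expTrace_add {A B : Ω → Matrix (Fin n) (Fin n) ℂ}
    (hA : Integrable (fun ω => (A ω).trace) P) (hB : Integrable (fun ω => (B ω).trace) P) :
    expTrace P (fun ω => A ω + B ω) = expTrace P A + expTrace P B := by
  simp only [expTrace, Matrix.trace_add]
  rw [integral_add hA hB, mul_add]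

lemma expTrace_smul (c : ℂ) (A : Ω → Matrix (Fin n) (Fin n) ℂ) :
    expTrace P (fun ω => c • A ω) = c * expTrace P A := by
  simp only [expTrace, Matrix.trace_smul, smul_eq_mul]
  rw [integral_const_mul, mul_left_comm]

lemma integrable_trace_eval {ι : Type*} {M : ι → Ω → Matrix (Fin n) (Fin n) ℂ}
    (hM : ∀ w, Integrable (fun ω => (StarPoly.wordEval (fun i => M i ω) w).trace) P)
    (a : StarPoly ι) : Integrable (fun ω => (StarPoly.eval (fun i => M i ω) a).trace) P := by
  induction a using MonoidAlgebra.induction_linear with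
  | zero => simp
  | add a b ha hb =>
    simp only [map_add, Matrix.trace_add]
    exact ha.add hb
  | single w c =>
    simpa only [StarPoly.eval_single, Matrix.trace_smul, smul_eq_mul] using (hM w).const_mul c

end ExpTrace

variable {Ω : ℕ → Type*} [∀ n, MeasurableSpace (Ω n)] {P : ∀ n, Measure (Ω n)}

lemma tendsto_expTrace_eval {ι : Type*} {M : ∀ n, ι → Ω n → Matrix (Fin n) (Fin n) ℂ}
    {μ : FreeMonoid (ι × StarExp) → ℂ}
    (hM : ∀ n w, Integrable (fun ω => (StarPoly.wordEval (fun i => M n i ω) w).trace) (P n))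
    (hμ : ∀ w, Tendsto
      (fun n => expTrace (P n) fun ω => StarPoly.wordEval (fun i => M n i ω) w) atTop (𝓝 (μ w)))
    (a : StarPoly ι) :
    Tendsto (fun n => expTrace (P n) fun ω => StarPoly.eval (fun i => M n i ω) a) atTop
      (𝓝 (StarPoly.ofMoments μ a)) := by
  induction a using MonoidAlgebra.induction_linear with
  | zero => simp [expTrace]
  | add a b ha hb =>
    simpa only [map_add, expTrace_add (integrable_trace_eval (hM _) a)
      (integrable_trace_eval (hM _) b)] using ha.add hb
  | single w c =>
    simpa only [StarPoly.eval_single, StarPoly.ofMoments_single, expTrace_smul] using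
      (hμ w).const_mul c

lemma isStarState_of_tendsto_expTrace_eval [∀ n, IsProbabilityMeasure (P n)] {ι : Type*}
    {M : ∀ n, ι → Ω n → Matrix (Fin n) (Fin n) ℂ} {φ : StarPoly ι →ₗ[ℂ] ℂ}
    (hφ : ∀ a, Tendsto
      (fun n => expTrace (P n) fun ω => StarPoly.eval (fun i => M n i ω) a) atTop (𝓝 (φ a))) :
    IsStarState φ where
  map_one := by
    refine tendsto_nhds_unique (hφ 1) (tendsto_const_nhds.congr' ?_)
    filter_upwards [eventually_ne_atTop 0] with n hn
    simp only [map_one, expTrace_one hn]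
  nonneg a := by
    have hlim := hφ (a * star a)
    simp only [map_mul, StarPoly.eval_star, expTrace_mul_star_self] at hlim
    constructor
    · refine ge_of_tendsto' ((Complex.continuous_re.tendsto _).comp hlim) fun n => ?_
      exact mul_nonneg (by positivity) (integral_nonneg fun ω => by positivity)
    · refine tendsto_nhds_unique ((Complex.continuous_im.tendsto _).comp hlim) ?_
      exact tendsto_const_nhds.congr fun n => (Complex.ofReal_im _).symm

lemma exists_isStarState_convergesInStarDistribution [∀ n, IsProbabilityMeasure (P n)] {m : ℕ}
    {M : ∀ n, Fin m → Ω n → Matrix (Fin n) (Fin n) ℂ}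
    (hM : ∀ n (p : ℕ) (τ : Fin p → Fin m) (ε : Fin p → StarExp),
      Integrable (fun ω => (starWord (fun i => M n i ω) τ ε).trace) (P n))
    (hlim : ∀ (p : ℕ) (τ : Fin p → Fin m) (ε : Fin p → StarExp), ∃ l : ℂ,
      Tendsto (fun n => expTrace (P n) fun ω => starWord (fun i => M n i ω) τ ε) atTop (𝓝 l)) :
    ∃ φ : StarPoly (Fin m) →ₗ[ℂ] ℂ,
      IsStarState φ ∧ ConvergesInStarDistribution P M φ StarPoly.X := by
  choose μ hμ using hlim
  have hφ := tendsto_expTrace_eval (P := P) (M := M)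
    (μ := fun w => μ w.toList.length (fun t => (w.toList.get t).1) fun t => (w.toList.get t).2)
    (fun n w => by simpa only [StarPoly.wordEval_eq_starWord] using hM n _ _ _)
    (fun w => by simpa only [StarPoly.wordEval_eq_starWord] using hμ _ _ _)
  refine ⟨_, isStarState_of_tendsto_expTrace_eval hφ, fun p τ ε => ?_⟩
  simpa only [StarPoly.eval_starWord] using hφ (starWord StarPoly.X τ ε)

end LimitState

section Moments

variable {Ω : ℕ → Type*} [∀ n, MeasurableSpace (Ω n)] {P : ∀ n, Measure (Ω n)} {m : ℕ}
  {ρ : Correlations}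

/-- What the moment method uses about the input pairs of the Hankel matrices `H_n^{(1)}, …,
H_n^{(m)}`: `Z n (i, j)` is the pair of index `j` of the `i`-th matrix. -/
structure HankelInputs (P : ∀ n, Measure (Ω n)) (ρ : Correlations)
    (Z : ∀ n, Fin m × ℤ → Ω n → ℂ × ℂ) : Prop where
  indep : ∀ n, iIndepFun (Z n) (P n)
  measurable : ∀ n b, Measurable (Z n b)
  integral_entry : ∀ n η c b, ∫ ω, entry η c (Z n b ω) ∂P n = 0
  integral_entry_mul_entry : ∀ n η c η' c' b,
    ∫ ω, entry η c (Z n b ω) * entry η' c' (Z n b ω) ∂P n = entryCov ρ η c η' c'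
  exists_moment_bound : ∀ q : ℕ, 1 ≤ q → ∃ C : ℝ, ∀ n η c b,
    Integrable (fun ω => ‖entry η c (Z n b ω)‖ ^ q) (P n) ∧
      ∫ ω, ‖entry η c (Z n b ω)‖ ^ q ∂P n ≤ C

lemma HankelInputs.of_inputAssumption {x y u v : ∀ n, Fin m → ℤ → Ω n → ℝ}
    (hinput : ∀ i : Fin m, InputAssumption P ρ
      (fun n => x n i) (fun n => y n i) (fun n => u n i) (fun n => v n i))
    (hindep : ∀ n, iIndepFun
      (fun (i : Fin m) (ω : Ω n) (j : ℤ) =>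
        (toComplex (x n i j) (y n i j) ω, toComplex (u n i j) (v n i j) ω)) (P n)) :
    HankelInputs P ρ fun n b ω =>
      (toComplex (x n b.1 b.2) (y n b.1 b.2) ω, toComplex (u n b.1 b.2) (v n b.1 b.2) ω) where
  indep n := iIndepFun_uncurry'
    (X := fun i j ω => (toComplex (x n i j) (y n i j) ω, toComplex (u n i j) (v n i j) ω))
    (fun i j => (hinput i).measurable_pair n j) (hindep n) fun i => (hinput i).indep n
  measurable n b := (hinput b.1).measurable_pair n b.2
  integral_entry n η c b := (hinput b.1).integral_entry n η c b.2
  integral_entry_mul_entry n η c η' c' b :=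
    (hinput b.1).integral_entry_mul_entry n η η' c c' b.2
  exists_moment_bound q hq := by
    choose C hC using fun i => (hinput i).exists_moment_bound hq
    refine ⟨∑ i, |C i|, fun n η c b => ⟨(hC b.1 n η c b.2).1, ?_⟩⟩
    refine ((hC b.1 n η c b.2).2.trans (le_abs_self _)).trans ?_
    exact Finset.single_le_sum (f := fun i => |C i|) (fun i _ => abs_nonneg _) (Finset.mem_univ _)

lemma sum_wickSum_pathInput (ρ : Correlations) {k : ℕ} (τ : Fin (2 * k) → Fin m)
    (ε : Fin (2 * k) → StarExp) (n : ℕ) :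
    ∑ w ∈ closedPaths (Fin n) (2 * k), wickSum (pathInput τ w) (pathCov ρ ε w) =
      ∑ π : PairPartition k, (∏ t, (kron (τ (π.r t)) (τ (π.s t)) : ℂ)) *
        ∑ q ∈ Finset.Ico (0 : ℤ) n, ∑ J ∈ Fintype.piFinset fun _ : Fin k => Finset.Ico (-(n : ℤ)) n,
          latticeWeight π ε ρ n q J := by
  simp_rw [wickSum]
  rw [Finset.sum_comm]
  refine Finset.sum_congr rfl fun π _ => ?_
  rw [← sum_closedPaths_eq_sum_latticeWeight, Finset.mul_sum]
  refine Finset.sum_congr rfl fun w _ => ?_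
  rw [← Finset.prod_mul_distrib]
  refine Finset.prod_congr rfl fun t _ => ?_
  simp only [pathInput, Prod.mk.injEq, kron, ite_and]
  split_ifs <;> simp

lemma hankelMoment_eq_sum (ρ : Correlations) {k : ℕ} (τ : Fin (2 * k) → Fin m)
    (ε : Fin (2 * k) → StarExp) :
    hankelMoment ρ τ ε = ∑ π : PairPartition k, (∏ t, (kron (τ (π.r t)) (τ (π.s t)) : ℂ)) *
      ∫ z₀ in Set.Icc (0 : ℝ) 1, ∫ z in Set.Icc (fun _ : Fin k => (-1 : ℝ)) (fun _ => 1),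
        ∏ t : Fin k, hankelE ρ π ε (π.r t) (π.s t) z₀ z := by
  rw [hankelMoment]
  refine Finset.sum_congr rfl fun π _ => ?_
  simp_rw [Finset.prod_mul_distrib, integral_const_mul]

lemma inv_sqrt_pow_two_mul (n k : ℕ) :
    (((Real.sqrt n)⁻¹ : ℝ) : ℂ) ^ (2 * k) = (n : ℂ)⁻¹ ^ k := by
  rw [pow_mul, ← Complex.ofReal_pow, inv_pow, Real.sq_sqrt (Nat.cast_nonneg n)]
  push_cast
  rfl

lemma tendsto_sum_wickSum (ρ : Correlations) {k : ℕ} (τ : Fin (2 * k) → Fin m)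
    (ε : Fin (2 * k) → StarExp) :
    Tendsto (fun n : ℕ => (n : ℂ)⁻¹ * (((Real.sqrt n)⁻¹ : ℝ) : ℂ) ^ (2 * k) *
      ∑ w ∈ closedPaths (Fin n) (2 * k), wickSum (pathInput τ w) (pathCov ρ ε w)) atTop
      (𝓝 (hankelMoment ρ τ ε)) := by
  rw [hankelMoment_eq_sum]
  refine (tendsto_finsetSum Finset.univ fun (π : PairPartition k) _ =>
    (tendsto_sum_latticeWeight π ε ρ).const_mul _).congr fun n => ?_
  rw [sum_wickSum_pathInput, inv_sqrt_pow_two_mul, Finset.mul_sum]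
  refine Finset.sum_congr rfl fun π _ => ?_
  rw [← mul_assoc _ _ (∑ q ∈ _, _), mul_left_comm]

namespace HankelInputs

variable {Z : ∀ n, Fin m × ℤ → Ω n → ℂ × ℂ} {p : ℕ}

lemma exists_integral_path_bound [∀ n, IsProbabilityMeasure (P n)] (hZ : HankelInputs P ρ Z)
    (τ : Fin p → Fin m) (ε : Fin p → StarExp) :
    ∃ C : ℝ, ∀ n (w : Fin (p + 1) → Fin n),
      Integrable (fun ω => ∏ t, pathEntry ε w t (Z n (pathInput τ w t) ω)) (P n) ∧
        ‖∫ ω, ∏ t, pathEntry ε w t (Z n (pathInput τ w t) ω) ∂P n‖ ≤ C := by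
  obtain ⟨C, hC⟩ : ∃ C : ℝ, ∀ (_ : Fin p) n η c b,
      Integrable (fun ω => ‖entry η c (Z n b ω)‖ ^ Fintype.card (Fin p)) (P n) ∧
        ∫ ω, ‖entry η c (Z n b ω)‖ ^ Fintype.card (Fin p) ∂P n ≤ C := by
    rw [Fintype.card_fin]
    rcases p with _ | p
    · exact ⟨0, fun t => t.elim0⟩
    · exact (hZ.exists_moment_bound (p + 1) (by omega)).imp fun C hC _ => hC
  exact ⟨_, fun n w => integrable_prod_and_norm_integral_prod_le
    (fun t => (measurable_entry _ _).comp (hZ.measurable n _)) fun t => hC t n _ _ _⟩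

lemma integrable_trace [∀ n, IsProbabilityMeasure (P n)] (hZ : HankelInputs P ρ Z)
    (τ : Fin p → Fin m) (ε : Fin p → StarExp) (n : ℕ) :
    Integrable (fun ω => (starWord (normalizedHankel n fun b => Z n b ω) τ ε).trace) (P n) := by
  obtain ⟨C, hC⟩ := hZ.exists_integral_path_bound τ ε
  exact integrable_trace_starWord τ ε fun w => (hC n w).1

lemma expTrace_eq_sum_closedPaths [∀ n, IsProbabilityMeasure (P n)] (hZ : HankelInputs P ρ Z)
    (τ : Fin p → Fin m) (ε : Fin p → StarExp) (n : ℕ) :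
    expTrace (P n) (fun ω => starWord (normalizedHankel n fun b => Z n b ω) τ ε) =
      (n : ℂ)⁻¹ * (((Real.sqrt n)⁻¹ : ℝ) : ℂ) ^ p * ∑ w ∈ closedPaths (Fin n) p,
        ∫ ω, ∏ t, pathEntry ε w t (Z n (pathInput τ w t) ω) ∂P n := by
  obtain ⟨C, hC⟩ := hZ.exists_integral_path_bound τ ε
  exact expTrace_starWord τ ε fun w => (hC n w).1

lemma integral_path_eq_zero (hZ : HankelInputs P ρ Z) {τ : Fin p → Fin m} (ε : Fin p → StarExp)
    {n : ℕ} {w : Fin (p + 1) → Fin n}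
    (hw : ∃ t, ∀ s, pathInput τ w s = pathInput τ w t → s = t) :
    ∫ ω, ∏ t, pathEntry ε w t (Z n (pathInput τ w t) ω) ∂P n = 0 := by
  obtain ⟨t, ht⟩ := hw
  exact integral_prod_eq_zero_of_unique (hZ.indep n) (hZ.measurable n)
    (fun _ => measurable_entry _ _) ht (hZ.integral_entry n _ _ _)

lemma integral_path_eq_wickSum (hZ : HankelInputs P ρ Z) {k : ℕ} {τ : Fin (2 * k) → Fin m}
    (ε : Fin (2 * k) → StarExp) {n : ℕ} {w : Fin (2 * k + 1) → Fin n}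
    (hw : w ∈ closedPaths (Fin n) (2 * k)) (hdeg : w ∉ degeneratePaths n τ) :
    ∫ ω, ∏ t, pathEntry ε w t (Z n (pathInput τ w t) ω) ∂P n =
      wickSum (pathInput τ w) (pathCov ρ ε w) := by
  rcases exists_unique_or_two_mul_card_image_lt_or_isTwoToOne (pathInput τ w) with
    hunique | hfew | hpaired
  · rw [wickSum_eq_zero _ hunique, hZ.integral_path_eq_zero ε hunique]
  · rw [Fintype.card_fin] at hfew
    exact absurd (Finset.mem_filter.2 ⟨hw, hfew⟩) hdeg
  · obtain ⟨π, hπ⟩ := hpaired.exists_matches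
    rw [wickSum_eq_prod _ hpaired hπ, integral_prod_eq_prod_pairs (hZ.indep n) (hZ.measurable n)
      (F := pathEntry ε w) (fun _ => measurable_entry _ _) hpaired hπ]
    exact Finset.prod_congr rfl fun t _ => hZ.integral_entry_mul_entry n _ _ _ _ _

lemma tendsto_expTrace_odd [∀ n, IsProbabilityMeasure (P n)] (hZ : HankelInputs P ρ Z) {k : ℕ}
    (τ : Fin (2 * k + 1) → Fin m) (ε : Fin (2 * k + 1) → StarExp) :
    Tendsto (fun n => expTrace (P n) fun ω => starWord (normalizedHankel n fun b => Z n b ω) τ ε)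
      atTop (𝓝 0) := by
  obtain ⟨C, hC⟩ := hZ.exists_integral_path_bound τ ε
  simp_rw [hZ.expTrace_eq_sum_closedPaths]
  refine tendsto_sum_closedPaths_zero τ (fun n w => (hC n w).2) fun n w hw hdeg => ?_
  rcases exists_unique_or_two_mul_card_image_lt_or_isTwoToOne (pathInput τ w) with
    hunique | hfew | hpaired
  · exact hZ.integral_path_eq_zero ε hunique
  · rw [Fintype.card_fin] at hfew
    exact absurd (Finset.mem_filter.2 ⟨hw, hfew⟩) hdeg
  · have := hpaired.two_mul_card_image
    rw [Fintype.card_fin] at this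
    omega

lemma tendsto_expTrace_even [∀ n, IsProbabilityMeasure (P n)] (hZ : HankelInputs P ρ Z) {k : ℕ}
    (τ : Fin (2 * k) → Fin m) (ε : Fin (2 * k) → StarExp) :
    Tendsto (fun n => expTrace (P n) fun ω => starWord (normalizedHankel n fun b => Z n b ω) τ ε)
      atTop (𝓝 (hankelMoment ρ τ ε)) := by
  obtain ⟨C, hC⟩ := hZ.exists_integral_path_bound τ ε
  obtain ⟨C', hC'₀, hC'⟩ := exists_norm_entryCov_le ρ
  have herror := tendsto_sum_closedPaths_zero τ (D := fun n w =>
    ∫ ω, ∏ t, pathEntry ε w t (Z n (pathInput τ w t) ω) ∂P n -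
      wickSum (pathInput τ w) (pathCov ρ ε w))
    (fun n w => (norm_sub_le _ _).trans (add_le_add (hC n w).2
      (norm_wickSum_le _ (fun i j => hC' _ _ _ _) hC'₀)))
    (fun n w hw hdeg => sub_eq_zero.2 (hZ.integral_path_eq_wickSum ε hw hdeg))
  have hsum := herror.add (tendsto_sum_wickSum ρ τ ε)
  rw [zero_add] at hsum
  refine hsum.congr fun n => ?_
  rw [hZ.expTrace_eq_sum_closedPaths, Finset.sum_sub_distrib, ← mul_add, sub_add_cancel]

end HankelInputs

end Moments

theorem mainTheorem4 {Ω : ℕ → Type*} [∀ n, MeasurableSpace (Ω n)]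
    (P : ∀ n, Measure (Ω n)) [∀ n, IsProbabilityMeasure (P n)]
    (m : ℕ) (ρ : Correlations) (x y u v : ∀ n, Fin m → ℤ → Ω n → ℝ)
    (hinput : ∀ i : Fin m, InputAssumption P ρ
      (fun n => x n i) (fun n => y n i) (fun n => u n i) (fun n => v n i))
    (hindep : ∀ n, iIndepFun
      (fun (i : Fin m) (ω : Ω n) (j : ℤ) =>
        (toComplex (x n i j) (y n i j) ω, toComplex (u n i j) (v n i j) ω)) (P n)) :
    ∃ (A : Type) (_ : Ring A) (_ : StarRing A) (_ : Algebra ℂ A) (_ : StarModule ℂ A)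
      (φ : A →ₗ[ℂ] ℂ) (h : Fin m → A),
      IsStarState φ ∧
      ConvergesInStarDistribution P
        (fun n i ω => (((Real.sqrt n)⁻¹ : ℝ) : ℂ) •
          hankel n (fun j => toComplex (x n i j) (y n i j) ω)
            (fun j => toComplex (u n i j) (v n i j) ω)) φ h ∧
      (∀ (k : ℕ) (τ : Fin (2 * k + 1) → Fin m) (ε : Fin (2 * k + 1) → StarExp),
        φ (starWord h τ ε) = 0) ∧
      (∀ (k : ℕ) (τ : Fin (2 * k) → Fin m) (ε : Fin (2 * k) → StarExp),
        φ (starWord h τ ε) = hankelMoment ρ τ ε) := by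
  have hZ := HankelInputs.of_inputAssumption hinput hindep
  obtain ⟨φ, hφ, hlim⟩ := exists_isStarState_convergesInStarDistribution
    (fun n p τ ε => hZ.integrable_trace τ ε n) fun p τ ε => by
      obtain ⟨k, rfl | rfl⟩ := Nat.even_or_odd' p
      · exact ⟨_, hZ.tendsto_expTrace_even τ ε⟩
      · exact ⟨_, hZ.tendsto_expTrace_odd τ ε⟩
  exact ⟨StarPoly (Fin m), inferInstance, inferInstance, inferInstance, inferInstance, φ,
    StarPoly.X, hφ, hlim,
    fun k τ ε => tendsto_nhds_unique (hlim _ τ ε) (hZ.tendsto_expTrace_odd τ ε),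
    fun k τ ε => tendsto_nhds_unique (hlim _ τ ε) (hZ.tendsto_expTrace_even τ ε)⟩
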